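/- **Setting.** Let $d\ge 0$, and let $Z_i=(X_i,W_i,Y_i,H_i)$, $i\ge 1$, be i.i.d. with covariates $X_i\in\mathbb R^d$ (row vectors), treatment $W_i\in\{0,1\}$, outcome $Y_i\in\mathbb R$ and study label $H_i\in\{1,\dots,K\}$. Let $Y_i=W_iY_i(1)+(1-W_i)Y_i(0)$ with potential outcomes $Y_i(0),Y_i(1)$, let $\rho_k=\mathbb P(H_i=k)>0$, $p_k=\mathbb P(W_i=1\mid H_i=k)\in(0,1)$ and $p=\sum_k\rho_kp_k$, and assume that for $w=0,1$ the pair $(X_i,Y_i(w))$ is independent of $(W_i,H_i)$ (randomized treatment, homogeneous population). Assume $X_i,Y_i(0),Y_i(1)$ are square integrable and $$Y_i(w)=c^{(w)}+X_i\beta^{(w)}+\varepsilon_i(w),\qquad \mathbb E(\varepsilon_i(w)\mid X_i)=0,\qquad \mathbb V(\varepsilon_i(w)\mid X_i)=\sigma^2 ,$$ and that $\Sigma=\mathbb V(X_i)$ is positive definite; $\mathbb E(X_i)$ is arbitrary (the covariates need not be centered). Put $\tau=\mathbb E(Y_i(1)-Y_i(0))$, $\|b\|_\Sigma^2=b^\top\Sigma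 b$, $\Delta=\|\beta^{(1)}-\beta^{(0)}\|_\Sigma^2$ and $V_k=\frac{\sigma^2}{p_k(1-p_k)}+\Delta$. **Estimators** from $Z_1,\dots,Z_n$. Let $X'_i=(1,X_i)$, and let $n_k$, $n^{(w)}$, $n_k^{(w)}$ be the numbers of observations in study $k$, in arm $w$, and in both. Let $\hat\theta^{(w)}_{\rm pool}$ and $\hat\theta_k^{(w)}$ be the OLS estimators $({X'}^\top X')^{-1}{X'}^\top Y$ over the observations in arm $w$, respectively in study $k$ and arm $w$ (the inverse of a singular matrix, and a division by zero, being read as $0$). Define - $\hat\tau_{\rm pool}=\frac1n\sum_{i\le n}X'_i(\hat\theta^{(1)}_{\rm pool}-\hat\theta^{(0)}_{\rm pool})$ and $\hat\tau_k=\frac1{n_k}\sum_{i\le n:\,H_i=k}X'_i(\hat\theta^{(1)}_k-\hat\theta^{(0)}_k)$; - $\hat\tau_{\rm Meta\text{-}SW}=\sum_k\frac{n_k}n\hat\tau_k$ and $\hat\tau_{\rm Meta\text{-}IVW}=\big(\sum_kv_k^{-1}\hat\tau_k\big)/\sum_kv_k^{-1}$, where $v_k$ is either the asymptotic variance $V_k/n_k$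 of $\hat\tau_k$ or any measurable approximation of it (random or not) with $n_kv_k\to V_k$ in probability for every $k$; - for $\mathrm{fed}\in\{\text{1S-SW},\text{1S-IVW},\mathrm{GD}\}$, $\hat\tau_{\rm fed}=\sum_k\frac{n_k}n\Big(\frac1{n_k}\sum_{i\le n:\,H_i=k}X'_i(\hat\theta^{(1)}_{\rm fed}-\hat\theta^{(0)}_{\rm fed})\Big)$ with $\hat\theta^{(w)}_{\rm 1S\text{-}SW}=\sum_k\frac{n_k^{(w)}}{n^{(w)}}\hat\theta_k^{(w)}$, with $\hat\theta^{(w)}_{\rm 1S\text{-}IVW}=\big(\sum_kP_k^{(w)}\big)^{-1}\sum_kP_k^{(w)}\hat\theta^{(w)}_k$, where $P^{(w)}_k=\sigma^{-2}{X'}^\top X'$ over study $k$ and arm $w$, and with $\hat\theta^{(w)}_{\rm GD}$ the limit, as the number of rounds tends to infinity (a fixed value if there is no limit), of full-batch FedAvg for the mean squared error in arm $w$ (each round: $E$ gradient steps with learning rate $\eta$ at every study, then averaging with weights $n_k^{(w)}/n^{(w)}$), run with measurable, possibly data-dependent $\eta$ and initial value such that, almost surely, whenever both pooled matrices ${X'}^\top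 X'$ are invertible, FedAvg converges to $\hat\theta^{(w)}_{\rm pool}$ for $w=0,1$. **Claim.** With probability tending to one, the matrices ${X'}^\top X'$ over all pairs (study, arm) are invertible, and as $n\to\infty$, in distribution, $$\sqrt n(\hat\tau_{\rm pool}-\tau)\to\mathcal N\Big(0,\tfrac{\sigma^2}{p(1-p)}+\Delta\Big),\qquad \sqrt{n_k}(\hat\tau_k-\tau)\to\mathcal N(0,V_k)\quad(1\le k\le K),$$ $$\sqrt n(\hat\tau_{\rm Meta\text{-}SW}-\tau)\to\mathcal N\Big(0,\sigma^2\sum_k\tfrac{\rho_k}{p_k(1-p_k)}+\Delta\Big),\qquad \sqrt n(\hat\tau_{\rm Meta\text{-}IVW}-\tau)\to\mathcal N\Big(0,\Big(\sum_k\tfrac{\rho_k}{V_k}\Big)^{-1}\Big),$$ $$\sqrt n(\hat\tau_{\rm fed}-\tau)\to\mathcal N\Big(0,\tfrac{\sigma^2}{p(1-p)}+\Delta\Big)\quad\text{for }\mathrm{fed}\in\{\text{1S-SW},\text{1S-IVW},\mathrm{GD}\},$$ where the inverse-variance statements are for $V_k>0$ for all $k$ (Meta-IVW) and $\sigma\neq0$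 (1S-IVW). Moreover, for any data for which the pooled matrix ${X'}^\top X'$ of arm $w$ is invertible, FedAvg with $E=1$ and $0<\eta<2/L$, where $L$ is the largest eigenvalue of $\frac2{n^{(w)}}{X'}^\top X'$, converges to $\hat\theta^{(w)}_{\rm pool}$ from any initial value. -/

import Mathlib

open MeasureTheory ProbabilityTheory Filter Topology

noncomputable section

namespace FedATE

/-- One observation `z = (x, w, y, h)`: covariates `x ∈ ℝ^d`, treatment `w ∈ {0, 1}`, observed
outcome `y ∈ ℝ` and study label `h` (one of `K` studies). -/
abbrev Obs (d K : ℕ) : Type := (Fin d → ℝ) × Fin 2 × ℝ × Fin K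

namespace Obs

variable {d K : ℕ}

/-- The covariates augmented with a leading one, `x' = (1, x) ∈ ℝ^(d+1)`. -/
def aug (z : Obs d K) : Fin (d + 1) → ℝ := Matrix.vecCons 1 z.1

/-- The treatment. -/
def trt (z : Obs d K) : Fin 2 := z.2.1

/-- The observed outcome. -/
def out (z : Obs d K) : ℝ := z.2.2.1

/-- The study label. -/
def study (z : Obs d K) : Fin K := z.2.2.2

end Obs

section Estimators

variable {d K : ℕ}

/-! ### Subsamples

`z : ℕ → Obs d K` is a sequence of observations; the sample of size `n` consists of the
observations with index `i < n`, and a subsample is given by its finite set of indices. -/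

/-- The indices of the observations under treatment arm `w`; its size is `n^(w)`. -/
def armIdx (n : ℕ) (z : ℕ → Obs d K) (w : Fin 2) : Finset ℕ :=
  (Finset.range n).filter fun i => (z i).trt = w

/-- The indices of the observations of study `k`; its size is `n_k`. -/
def studyIdx (n : ℕ) (z : ℕ → Obs d K) (k : Fin K) : Finset ℕ :=
  (Finset.range n).filter fun i => (z i).study = k

/-- The indices of the observations of study `k` under treatment arm `w`; its size is `n_k^(w)`. -/
def cellIdx (n : ℕ) (z : ℕ → Obs d K) (k : Fin K) (w : Fin 2) : Finset ℕ :=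
  (Finset.range n).filter fun i => (z i).study = k ∧ (z i).trt = w

/-! ### Ordinary least squares and the plug-in G-formula -/

/-- The Gram matrix `X'ᵀ X' = ∑_{i ∈ S} x'_i x'_iᵀ` of the augmented design matrix whose rows are
the `x'_i`, `i ∈ S`. -/
def gram (z : ℕ → Obs d K) (S : Finset ℕ) : Matrix (Fin (d + 1)) (Fin (d + 1)) ℝ :=
  ∑ i ∈ S, Matrix.vecMulVec (z i).aug (z i).aug

/-- The vector `X'ᵀ Y = ∑_{i ∈ S} y_i x'_i`. -/
def moment (z : ℕ → Obs d K) (S : Finset ℕ) : Fin (d + 1) → ℝ :=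
  ∑ i ∈ S, (z i).out • (z i).aug

/-- The OLS estimator `(X'ᵀ X')⁻¹ X'ᵀ Y` over the subsample `S`. (The inverse is the zero matrix
when `X'ᵀ X'` is singular.) -/
def ols (z : ℕ → Obs d K) (S : Finset ℕ) : Fin (d + 1) → ℝ :=
  (gram z S)⁻¹.mulVec (moment z S)

/-- The plug-in G-formula over the subsample `S` with linear outcome models of parameters
`θ 1` and `θ 0`: the average over `i ∈ S` of `x'_i θ 1 - x'_i θ 0`. -/
def gFormula (z : ℕ → Obs d K) (S : Finset ℕ) (θ : Fin 2 → Fin (d + 1) → ℝ) : ℝ :=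
  (1 / (S.card : ℝ)) * ∑ i ∈ S, ((z i).aug ⬝ᵥ θ 1 - (z i).aug ⬝ᵥ θ 0)

/-- Local full rank: every design matrix `X'_k^(w)` has full column rank. -/
def LocalFullRank (n : ℕ) (z : ℕ → Obs d K) : Prop :=
  ∀ k w, IsUnit (gram z (cellIdx n z k w)).det

/-- Federated full rank: both pooled design matrices `X'^(w)` have full column rank. -/
def FederatedFullRank (n : ℕ) (z : ℕ → Obs d K) : Prop :=
  ∀ w, IsUnit (gram z (armIdx n z w)).det

/-! ### Pooled, local and meta-analysis estimators -/

/-- The pooled OLS estimator of the outcome parameters in arm `w`. -/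
def thetaPool (n : ℕ) (z : ℕ → Obs d K) (w : Fin 2) : Fin (d + 1) → ℝ :=
  ols z (armIdx n z w)

/-- The pooled estimator of the ATE. -/
def tauPool (n : ℕ) (z : ℕ → Obs d K) : ℝ :=
  gFormula z (Finset.range n) (thetaPool n z)

/-- The local OLS estimator of the outcome parameters in study `k` and arm `w`. -/
def thetaLocal (n : ℕ) (z : ℕ → Obs d K) (k : Fin K) (w : Fin 2) : Fin (d + 1) → ℝ :=
  ols z (cellIdx n z k w)

/-- The local estimator of the ATE in study `k`. -/
def tauLocal (n : ℕ) (z : ℕ → Obs d K) (k : Fin K) : ℝ :=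
  gFormula z (studyIdx n z k) (thetaLocal n z k)

/-- The meta-analysis estimator with sample size weights `n_k / n`. -/
def tauMetaSW (n : ℕ) (z : ℕ → Obs d K) : ℝ :=
  ∑ k, (((studyIdx n z k).card : ℝ) / n) * tauLocal n z k

/-- The meta-analysis estimator with inverse variance weights, where `v k` is the variance
attributed to the local estimator of study `k`. -/
def tauMetaIVW (v : Fin K → ℝ) (n : ℕ) (z : ℕ → Obs d K) : ℝ :=
  (∑ k, (v k)⁻¹ * tauLocal n z k) / ∑ k, (v k)⁻¹

/-! ### Federated estimators -/

/-- Sample size aggregation, with weights `n_k / n`, of the local estimates of the ATE that the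
studies compute with common outcome parameters `θ`. -/
def aggregateSW (n : ℕ) (z : ℕ → Obs d K) (θ : Fin 2 → Fin (d + 1) → ℝ) : ℝ :=
  ∑ k, (((studyIdx n z k).card : ℝ) / n) * gFormula z (studyIdx n z k) θ

/-- One-shot federation of the local OLS parameters with weights `n_k^(w) / n^(w)`. -/
def theta1SSW (n : ℕ) (z : ℕ → Obs d K) (w : Fin 2) : Fin (d + 1) → ℝ :=
  ∑ k, (((cellIdx n z k w).card : ℝ) / ((armIdx n z w).card : ℝ)) • thetaLocal n z k w

/-- The inverse variance matrix `σ⁻² X'_k^(w)ᵀ X'_k^(w)` of the local OLS parameters. -/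
def precision (σ : ℝ) (n : ℕ) (z : ℕ → Obs d K) (k : Fin K) (w : Fin 2) :
    Matrix (Fin (d + 1)) (Fin (d + 1)) ℝ :=
  (1 / σ ^ 2) • gram z (cellIdx n z k w)

/-- One-shot federation of the local OLS parameters with inverse variance weights. -/
def theta1SIVW (σ : ℝ) (n : ℕ) (z : ℕ → Obs d K) (w : Fin 2) : Fin (d + 1) → ℝ :=
  (∑ k, precision σ n z k w)⁻¹.mulVec
    (∑ k, (precision σ n z k w).mulVec (thetaLocal n z k w))

/-- The one-shot estimator of the ATE with sample size federation of the parameters. -/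
def tau1SSW (n : ℕ) (z : ℕ → Obs d K) : ℝ :=
  aggregateSW n z (theta1SSW n z)

/-- The one-shot estimator of the ATE with inverse variance federation of the parameters. -/
def tau1SIVW (σ : ℝ) (n : ℕ) (z : ℕ → Obs d K) : ℝ :=
  aggregateSW n z (theta1SIVW σ n z)

/-- One gradient step with learning rate `η` for the mean squared error over the subsample `S`,
whose gradient at `θ` is `-(2 / |S|) X'ᵀ (Y - X' θ)`. -/
def gradStep (η : ℝ) (z : ℕ → Obs d K) (S : Finset ℕ) (θ : Fin (d + 1) → ℝ) : Fin (d + 1) → ℝ :=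
  θ - η • (-(2 / (S.card : ℝ))) • ∑ i ∈ S, ((z i).out - (z i).aug ⬝ᵥ θ) • (z i).aug

/-- One round of (full-batch) FedAvg in arm `w`: each study performs `E` gradient steps on its own
data, and the server averages the results with weights `n_k^(w) / n^(w)`. -/
def fedAvgRound (E : ℕ) (η : ℝ) (n : ℕ) (z : ℕ → Obs d K) (w : Fin 2) (θ : Fin (d + 1) → ℝ) :
    Fin (d + 1) → ℝ :=
  ∑ k, (((cellIdx n z k w).card : ℝ) / ((armIdx n z w).card : ℝ)) •
    (gradStep η z (cellIdx n z k w))^[E] θ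

/-- The output of FedAvg in arm `w` after `T` rounds, with `E` local steps per round, learning
rate `η` and initial value `θ₀`. -/
def fedAvg (E : ℕ) (η : ℝ) (θ₀ : Fin (d + 1) → ℝ) (n : ℕ) (z : ℕ → Obs d K) (w : Fin 2) (T : ℕ) :
    Fin (d + 1) → ℝ :=
  (fedAvgRound E η n z w)^[T] θ₀

/-- The parameters learned by FedAvg run until convergence. -/
def thetaGD (E : ℕ) (η : Fin 2 → ℝ) (θ₀ : Fin 2 → Fin (d + 1) → ℝ) (n : ℕ) (z : ℕ → Obs d K)
    (w : Fin 2) : Fin (d + 1) → ℝ :=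
  limUnder atTop (fedAvg E (η w) (θ₀ w) n z w)

/-- The gradient-based federated estimator of the ATE. -/
def tauGD (E : ℕ) (η : Fin 2 → ℝ) (θ₀ : Fin 2 → Fin (d + 1) → ℝ) (n : ℕ) (z : ℕ → Obs d K) : ℝ :=
  aggregateSW n z (thetaGD E η θ₀ n z)

end Estimators

section Model

variable {Ω : Type*} [MeasurableSpace Ω] {d K : ℕ}

/-- The observation `Z_i = (X_i, W_i, Y_i, H_i)`, where the observed outcome is the potential
outcome of the received treatment, `Y_i = W_i Y_i(1) + (1 - W_i) Y_i(0)`.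
Here `Y w i` is the potential outcome `Y_i(w)`. -/
def obs (X : ℕ → Ω → Fin d → ℝ) (W : ℕ → Ω → Fin 2) (H : ℕ → Ω → Fin K)
    (Y : Fin 2 → ℕ → Ω → ℝ) (i : ℕ) (ω : Ω) : Obs d K :=
  (X i ω, W i ω, Y (W i ω) i ω, H i ω)

/-- The residual `ε_i(w) = Y_i(w) - c^(w) - X_i β^(w)` of the linear outcome model. -/
def resid (X : ℕ → Ω → Fin d → ℝ) (Y : Fin 2 → ℕ → Ω → ℝ) (c : Fin 2 → ℝ)
    (β : Fin 2 → Fin d → ℝ) (w : Fin 2) (i : ℕ) (ω : Ω) : ℝ :=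
  Y w i ω - (c w + X i ω ⬝ᵥ β w)

/-- The covariance matrix of a random vector. -/
def covMatrix (P : Measure Ω) (V : Ω → Fin d → ℝ) : Matrix (Fin d) (Fin d) ℝ :=
  Matrix.of fun a b => cov[fun ω => V ω a, fun ω => V ω b; P]

/-- The average treatment effect `E(Y(1) - Y(0))`. -/
def ate (P : Measure Ω) (Y : Fin 2 → ℕ → Ω → ℝ) : ℝ := ∫ ω, (Y 1 0 ω - Y 0 0 ω) ∂P

/-- The homogeneous linear model for `K` Bernoulli trials that study the same population. -/
structure HomogeneousModel (P : Measure Ω) (X : ℕ → Ω → Fin d → ℝ) (W : ℕ → Ω → Fin 2)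
    (H : ℕ → Ω → Fin K) (Y : Fin 2 → ℕ → Ω → ℝ) (ρ : Fin K → ℝ) (prob : Fin K → ℝ)
    (c : Fin 2 → ℝ) (β : Fin 2 → Fin d → ℝ) (σ : ℝ) : Prop where
  measurable_X : ∀ i, Measurable (X i)
  measurable_W : ∀ i, Measurable (W i)
  measurable_H : ∀ i, Measurable (H i)
  measurable_Y : ∀ w i, Measurable (Y w i)
  /-- The observations are independent. -/
  indep : iIndepFun (obs X W H Y) P
  /-- The observations are identically distributed. -/
  ident : ∀ i, IdentDistrib (obs X W H Y i) (obs X W H Y 0) P P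
  /-- Study `k` has probability `ρ k > 0`. -/
  study_prob : ∀ i k, P.real {ω | H i ω = k} = ρ k
  study_pos : ∀ k, 0 < ρ k
  /-- In study `k` the treatment is assigned with probability `prob k ∈ (0, 1)`. -/
  treat_prob : ∀ i k, (ProbabilityTheory.cond P {ω | H i ω = k}).real {ω | W i ω = 1} = prob k
  treat_pos : ∀ k, 0 < prob k
  treat_lt_one : ∀ k, prob k < 1
  /-- Randomization and homogeneity: the covariates and each potential outcome are (jointly)
  independent of the pair of the treatment and the study. -/
  randomized : ∀ w i, IndepFun (fun ω => (X i ω, Y w i ω)) (fun ω => (W i ω, H i ω)) P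
  /-- Finite second moments. -/
  memLp_X : ∀ i, MemLp (X i) 2 P
  memLp_Y : ∀ w i, MemLp (Y w i) 2 P
  /-- `E(ε(w) | X) = 0`. -/
  resid_mean : ∀ w i,
    P[resid X Y c β w i | MeasurableSpace.comap (X i) inferInstance] =ᵐ[P] fun _ => 0
  /-- `V(ε(w) | X) = σ²`. -/
  resid_var : ∀ w i,
    Var[resid X Y c β w i; P | MeasurableSpace.comap (X i) inferInstance] =ᵐ[P] fun _ => σ ^ 2
  /-- The covariance matrix of the covariates is nonsingular. -/
  cov_posDef : (covMatrix P (X 0)).PosDef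

/-- `T n` converges in distribution to the centered normal law of variance `V`. -/
def AsympNormal (P : Measure Ω) [IsProbabilityMeasure P] (T : ℕ → Ω → ℝ) (V : ℝ) : Prop :=
  TendstoInDistribution T atTop (id : ℝ → ℝ) (fun _ => P) (gaussianReal 0 V.toNNReal)

end Model

end FedATE

end

/-! Every estimator is a plug-in G-formula, or a combination of such, with OLS parameters. Where the
Gram matrices are invertible, `ols_sub` writes the parameter error as an inverse Gram matrix applied
to a score, a sum of residuals times `x'`. By `gFormula_sub` the ATE error is then an average of the
centered effects `X (β 1 - β 0)` plus signed terms: mean of `x'`, times inverse Gram matrix, times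
score. Split over the cells (study, arm), it is a linear combination, with random coefficients, of
normalized i.i.d. centered sums.

The law of large numbers gives the coefficients. With `M` the second moment matrix of `(1, X)`, the
Gram matrix over a subsample of asymptotic proportion `q`, divided by `n`, tends to `q M`. The mean
of `x'` tends to row `0` of `M`, and this row times `M⁻¹` is the basis vector `e₀`
(`GramLimit.tendsto_vecMul`). So only the intercept coordinate of the score survives, that is, the
sum of the residuals, whatever the mean of `X`. By Slutsky and the scalar central limit theorem
(`asympNormal_of_linear`) the limit is normal.

Its variance is computed once, in `integral_sq_sum_cellFun`: cells are disjoint, residuals are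
orthogonal to functions of `X`, and randomization factorizes expectations over a cell. The variance
is a sum over cells of `ρ_k p_kw (α² Δ + b² σ²)`, where `α` and `b` are the limiting coefficients of
the effects and of the residuals. The estimators differ only in `α` and `b`.

For the federated estimators, aggregation over studies restores the G-formula over the whole sample
(`aggregateSW_eq`). With high probability 1S-IVW and GD equal the pooled estimator. 1S-SW does not,
but its coefficients have the same limits. Convergence of FedAvg with one local step is that of
gradient descent for a positive definite quadratic. -/

noncomputable section

namespace FedATE

/-! ### Convergence in probability, Slutsky's argument and the central limit theorem. -/

section Probability

variable {Ω : Type*} [MeasurableSpace Ω] {P : Measure Ω}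

/-- Continuous mapping for convergence in probability of finitely many sequences to constants. -/
theorem tendstoInMeasure_comp_of_continuousAt {ι : Type*} [Fintype ι] {f : ℕ → Ω → ι → ℝ}
    {a : ι → ℝ} (hf : ∀ j, TendstoInMeasure P (fun n ω => f n ω j) atTop (fun _ => a j))
    {g : (ι → ℝ) → ℝ} (hg : ContinuousAt g a) :
    TendstoInMeasure P (fun n ω => g (f n ω)) atTop (fun _ => g a) := by
  have hfj : TendstoInMeasure P f atTop (fun _ => a) := by
    rw [tendstoInMeasure_iff_dist]
    intro ε hε
    have hsum : Tendsto (fun n => ∑ j, P {ω | ε ≤ dist (f n ω j) (a j)}) atTop (𝓝 0) := by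
      have := tendsto_finsetSum (Finset.univ : Finset ι) fun j _ =>
        (tendstoInMeasure_iff_dist.1 (hf j)) ε hε
      simpa using this
    refine tendsto_of_tendsto_of_tendsto_of_le_of_le tendsto_const_nhds hsum (fun _ => zero_le)
      fun n => ?_
    refine (measure_mono ?_).trans (measure_iUnion_fintype_le P _)
    intro ω hω
    by_contra hcon
    simp only [Set.mem_iUnion, Set.mem_ofPred_eq, not_exists, not_le] at hcon
    exact absurd hω (not_le.2 ((dist_pi_lt_iff hε).2 hcon))
  rw [tendstoInMeasure_iff_dist]
  intro ε hε
  obtain ⟨r, hr, hrg⟩ := Metric.continuousAt_iff.1 hg ε hε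
  refine tendsto_of_tendsto_of_tendsto_of_le_of_le tendsto_const_nhds
    (tendstoInMeasure_iff_dist.1 hfj r hr) (fun _ => zero_le) fun n => measure_mono fun ω hω => ?_
  by_contra hcon
  exact absurd (hrg (not_le.1 hcon)) (not_lt.2 hω)

/-- A sequence that is bounded in `L²`, multiplied by one that tends to zero in probability, tends
to zero in probability. -/
theorem tendstoInMeasure_mul_of_sq_le [IsProbabilityMeasure P] {c u : ℕ → Ω → ℝ} {B : ℝ}
    (hc : TendstoInMeasure P c atTop (fun _ => 0)) (hu : ∀ n, MemLp (u n) 2 P)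
    (hB : ∀ n, ∫ ω, u n ω ^ 2 ∂P ≤ B) :
    TendstoInMeasure P (fun n ω => c n ω * u n ω) atTop (fun _ => 0) := by
  rw [tendstoInMeasure_iff_measureReal_dist] at hc ⊢
  simp only [dist_zero_right, Real.norm_eq_abs] at hc ⊢
  intro ε hε
  -- Truncation at `|c| < r`, `|u| < ε / r`, where the product is below `ε`. The Chebyshev term is
  -- uniform in `n`, so `r` can be fixed before `n` grows.
  have key : ∀ r > 0, ∀ n, P.real {ω | ε ≤ |c n ω * u n ω|} ≤
      P.real {ω | r ≤ |c n ω|} + B * (r / ε) ^ 2 := by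
    intro r hr n
    have hcheb : P.real {ω | (ε / r) ^ 2 ≤ u n ω ^ 2} ≤ B * (r / ε) ^ 2 := by
      have := mul_meas_ge_le_integral_of_nonneg (μ := P) (f := fun ω => u n ω ^ 2)
        (ae_of_all _ fun ω => sq_nonneg _) ((hu n).integrable_sq) ((ε / r) ^ 2)
      have h2 : (ε / r) ^ 2 * P.real {ω | (ε / r) ^ 2 ≤ u n ω ^ 2} ≤ B := this.trans (hB n)
      have h3 : (r / ε) ^ 2 * (ε / r) ^ 2 = 1 := by field_simp
      calc _ = (r / ε) ^ 2 * (ε / r) ^ 2 * P.real {ω | (ε / r) ^ 2 ≤ u n ω ^ 2} := by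
            rw [h3, one_mul]
        _ = (r / ε) ^ 2 * ((ε / r) ^ 2 * P.real {ω | (ε / r) ^ 2 ≤ u n ω ^ 2}) := by ring
        _ ≤ (r / ε) ^ 2 * B := by gcongr
        _ = _ := mul_comm _ _
    refine le_trans ?_ (add_le_add_right hcheb _)
    refine (measureReal_mono ?_).trans (measureReal_union_le _ _)
    intro ω hω
    by_contra hcon
    simp only [Set.mem_union, Set.mem_ofPred_eq, not_or, not_le] at hcon
    have h1 : |u n ω| < ε / r := by
      have := hcon.2
      exact abs_lt_of_sq_lt_sq this (by positivity)
    have : |c n ω * u n ω| < ε := by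
      rw [abs_mul]
      calc _ ≤ r * |u n ω| := by gcongr; exact hcon.1.le
        _ < r * (ε / r) := by gcongr
        _ = ε := by field_simp
    exact absurd hω (not_le.2 this)
  rw [Metric.tendsto_atTop]
  intro κ hκ
  obtain ⟨r, hr, hrκ⟩ : ∃ r > 0, B * (r / ε) ^ 2 < κ / 2 := by
    have : Tendsto (fun r : ℝ => B * (r / ε) ^ 2) (𝓝[>] 0) (𝓝 (B * (0 / ε) ^ 2)) :=
      (Continuous.tendsto (by fun_prop) 0).mono_left nhdsWithin_le_nhds
    have h2 := this.eventually_lt_const (u := κ / 2) (by simpa using half_pos hκ)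
    obtain ⟨r, h1, h2⟩ := (h2.and self_mem_nhdsWithin).exists
    exact ⟨r, h2, h1⟩
  obtain ⟨N, hN⟩ := Metric.tendsto_atTop.1 (hc r hr) (κ / 2) (half_pos hκ)
  refine ⟨N, fun n hn => ?_⟩
  have h1 := hN n hn
  rw [Real.dist_eq, sub_zero, abs_of_nonneg measureReal_nonneg] at h1 ⊢
  linarith [key r hr n]

theorem tendstoInMeasure_finsetSum_zero {ι : Type*} [Fintype ι] {f : ι → ℕ → Ω → ℝ}
    (hf : ∀ j, TendstoInMeasure P (f j) atTop (fun _ => 0)) :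
    TendstoInMeasure P (fun n ω => ∑ j, f j n ω) atTop (fun _ => 0) := by
  have := tendstoInMeasure_comp_of_continuousAt (P := P) (f := fun n ω j => f j n ω) (a := 0)
    hf (g := fun x => ∑ j, x j) (by fun_prop)
  simpa using this

/-- The second moment of a normalized sum of independent centered variables. -/
theorem integral_sq_normalized_sum [IsProbabilityMeasure P] {ξ : ℕ → Ω → ℝ} (hindep : iIndepFun ξ P)
    (hident : ∀ i, IdentDistrib (ξ i) (ξ 0) P P) (hL : MemLp (ξ 0) 2 P)
    (h0 : ∫ ω, ξ 0 ω ∂P = 0) (n : ℕ) :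
    ∫ ω, ((√(n : ℝ))⁻¹ * ∑ i ∈ Finset.range n, ξ i ω) ^ 2 ∂P ≤ ∫ ω, ξ 0 ω ^ 2 ∂P := by
  have hLi : ∀ i, MemLp (ξ i) 2 P := fun i => (hident i).memLp_iff.2 hL
  have hmean : ∀ i, ∫ ω, ξ i ω ∂P = 0 := fun i => (hident i).integral_eq.trans h0
  have hvar : Var[fun ω => ∑ i ∈ Finset.range n, ξ i ω; P] = n * ∫ ω, ξ 0 ω ^ 2 ∂P := by
    have h1 := IndepFun.variance_sum (μ := P) (X := ξ) (s := Finset.range n) (fun i _ => hLi i)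
      (fun i _ j _ hij => hindep.indepFun hij)
    have h2 : (∑ i ∈ Finset.range n, ξ i) = fun ω => ∑ i ∈ Finset.range n, ξ i ω := by
      ext ω; simp
    rw [h2] at h1
    rw [h1, Finset.sum_congr rfl fun i _ => (hident i).variance_eq]
    have h3 : Var[ξ 0; P] = ∫ ω, ξ 0 ω ^ 2 ∂P := by
      rw [variance_of_integral_eq_zero hL.aestronglyMeasurable.aemeasurable h0]
    simp [h3]
  have hS : MemLp (fun ω => ∑ i ∈ Finset.range n, ξ i ω) 2 P := memLp_finsetSum _ fun i _ => hLi i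
  rw [variance_of_integral_eq_zero hS.aestronglyMeasurable.aemeasurable
    (by rw [integral_finsetSum _ fun i _ => (hLi i).integrable (by norm_num)]; simp [hmean])]
    at hvar
  simp only [mul_pow]
  rw [integral_const_mul, hvar]
  rcases Nat.eq_zero_or_pos n with rfl | hn
  · simpa using integral_nonneg fun ω => sq_nonneg (ξ 0 ω)
  · have : (n : ℝ) ≠ 0 := by positivity
    rw [inv_pow, Real.sq_sqrt (by positivity), ← mul_assoc, inv_mul_cancel₀ this, one_mul]

/-- Asymptotic normality of a linear combination, with random coefficients that converge in
probability, of normalized sums of centered functions of an i.i.d. sequence. -/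
theorem asympNormal_of_linear [IsProbabilityMeasure P] {E ι : Type*}
    [MeasurableSpace E] [Fintype ι] {ξ : ℕ → Ω → E}
    (hindep : iIndepFun ξ P) (hident : ∀ i, IdentDistrib (ξ i) (ξ 0) P P)
    {ψ : ι → E → ℝ} (hψ : ∀ j, Measurable (ψ j)) (hL : ∀ j, MemLp (fun ω => ψ j (ξ 0 ω)) 2 P)
    (h0 : ∀ j, ∫ ω, ψ j (ξ 0 ω) ∂P = 0)
    {C : ℕ → Ω → ι → ℝ} {a : ι → ℝ}
    (hC : ∀ j, TendstoInMeasure P (fun n ω => C n ω j) atTop (fun _ => a j))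
    {T : ℕ → Ω → ℝ} (hTm : ∀ n, AEMeasurable (T n) P)
    (hT : Tendsto (fun n : ℕ => P {ω | T n ω ≠
      ∑ j, C n ω j * ((√(n : ℝ))⁻¹ * ∑ i ∈ Finset.range n, ψ j (ξ i ω))}) atTop (𝓝 0))
    {v : ℝ} (hv : ∫ ω, (∑ j, a j * ψ j (ξ 0 ω)) ^ 2 ∂P = v) :
    AsympNormal P T v := by
  set g : E → ℝ := fun z => ∑ j, a j * ψ j z with hg
  have hgm : Measurable g := Finset.measurable_sum _ fun j _ => (hψ j).const_mul _
  have hgL : MemLp (fun ω => g (ξ 0 ω)) 2 P := memLp_finsetSum _ fun j _ => (hL j).const_mul _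
  have hg0 : ∫ ω, g (ξ 0 ω) ∂P = 0 := by
    simp only [hg]
    rw [integral_finsetSum _ fun j _ => ((hL j).integrable (by norm_num)).const_mul _]
    simp [integral_const_mul, h0]
  have hgv : Var[fun ω => g (ξ 0 ω); P] = v := by
    rw [variance_of_integral_eq_zero hgL.aestronglyMeasurable.aemeasurable hg0, ← hv]
  -- With the coefficients frozen at their limits `a`, the combination is one normalized sum of `g`,
  -- so the scalar theorem suffices.
  have hclt := tendstoInDistribution_inv_sqrt_mul_sum_sub (P := P)
    (P' := gaussianReal 0 v.toNNReal) (Y := (id : ℝ → ℝ)) (X := fun i ω => g (ξ i ω))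
    (by rw [hgv]; exact HasLaw.id) hgL (hindep.comp (fun _ => g) fun _ => hgm)
    (fun i => (hident i).comp hgm)
  simp only [hg0, mul_zero, sub_zero] at hclt
  set U : ι → ℕ → Ω → ℝ := fun j n ω => (√(n : ℝ))⁻¹ * ∑ i ∈ Finset.range n, ψ j (ξ i ω) with hU
  have hUL : ∀ j n, MemLp (U j n) 2 P := fun j n =>
    (memLp_finsetSum _ fun i _ => ((hident i).comp (hψ j)).memLp_iff.2 (hL j)).const_mul _
  -- Replacing the random coefficients by their limits costs (null in probability) × (bounded in
  -- `L²`).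
  have hCU : TendstoInMeasure P (fun n ω => ∑ j, (C n ω j - a j) * U j n ω) atTop
      (fun _ => 0) := by
    refine tendstoInMeasure_finsetSum_zero fun j => ?_
    refine tendstoInMeasure_mul_of_sq_le ?_ (hUL j) (B := ∫ ω, ψ j (ξ 0 ω) ^ 2 ∂P) fun n =>
      integral_sq_normalized_sum (ξ := fun i ω => ψ j (ξ i ω)) (hindep.comp _ fun _ => hψ j)
        (fun i => (hident i).comp (hψ j)) (hL j) (h0 j) n
    have := hC j
    rw [tendstoInMeasure_iff_dist] at this ⊢
    simpa [Real.dist_eq] using this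
  have hrem : TendstoInMeasure P (fun n ω => T n ω - ∑ j, C n ω j * U j n ω) atTop
      (fun _ => 0) := by
    refine fun ε hε => tendsto_of_tendsto_of_tendsto_of_le_of_le tendsto_const_nhds hT
      (fun _ => zero_le) fun n => measure_mono fun ω hω heq => ?_
    have h1 : T n ω - ∑ j, C n ω j * U j n ω = 0 := sub_eq_zero.2 heq
    replace hω : ε ≤ edist (T n ω - ∑ j, C n ω j * U j n ω) 0 := hω
    rw [h1, edist_self] at hω
    exact absurd hω (not_le.2 hε)
  have hsum := tendstoInMeasure_finsetSum_zero (P := P) (ι := Bool)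
    (f := fun b => bif b then (fun n ω => T n ω - ∑ j, C n ω j * U j n ω) else
      (fun n ω => ∑ j, (C n ω j - a j) * U j n ω))
    (by rintro (_ | _) <;> assumption)
  refine tendstoInDistribution_of_tendstoInMeasure_sub T id hclt ?_ hTm
  change TendstoInMeasure P _ atTop (fun _ => 0)
  convert hsum using 1
  ext n ω
  simp only [Pi.sub_apply, Fintype.sum_bool, cond_true, cond_false, hg, hU]
  rw [Finset.sum_comm, Finset.mul_sum]
  simp only [sub_mul, Finset.sum_sub_distrib, ← Finset.mul_sum]
  rw [sub_add_sub_cancel]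
  rw [Finset.mul_sum]
  congr 1
  exact Finset.sum_congr rfl fun j _ => by ring

theorem tendstoInMeasure_mul {f g : ℕ → Ω → ℝ} {a b : ℝ}
    (hf : TendstoInMeasure P f atTop (fun _ => a)) (hg : TendstoInMeasure P g atTop (fun _ => b)) :
    TendstoInMeasure P (fun n ω => f n ω * g n ω) atTop (fun _ => a * b) := by
  simpa using tendstoInMeasure_comp_of_continuousAt (P := P) (f := fun n ω => ![f n ω, g n ω])
    (a := ![a, b]) (by intro j; fin_cases j <;> assumption) (g := fun x => x 0 * x 1) (by fun_prop)

/-- Events that eventually hold almost surely have probability tending to one. -/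
theorem tendsto_measure_one_of_ae_eventually [IsProbabilityMeasure P] {s : ℕ → Set Ω}
    (hs : ∀ n, MeasurableSet (s n))
    (h : ∀ᵐ ω ∂P, ∀ᶠ n in atTop, ω ∈ s n) : Tendsto (fun n => P (s n)) atTop (𝓝 1) := by
  have := tendsto_measure_of_ae_tendsto_indicator_of_isFiniteMeasure atTop (μ := P) (A := Set.univ)
    MeasurableSet.univ hs (by filter_upwards [h] with ω hω; simpa using hω)
  simpa using this

end Probability

/-! ### Measurability of the estimators as functions of the data. -/

section Measurability

variable {α : Type*} [MeasurableSpace α] {d K : ℕ}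

/-- A random finite set of indices `i < n`. -/
structure MeasurableIdx (n : ℕ) (S : α → Finset ℕ) : Prop where
  subset : ∀ a, S a ⊆ Finset.range n
  measurableSet_mem : ∀ i, MeasurableSet {a | i ∈ S a}

theorem MeasurableIdx.sum {n : ℕ} {S : α → Finset ℕ} (hS : MeasurableIdx n S) {f : α → ℕ → ℝ}
    (hf : ∀ i, Measurable fun a => f a i) : Measurable fun a => ∑ i ∈ S a, f a i := by
  have h : (fun a => ∑ i ∈ S a, f a i) =
      fun a => ∑ i ∈ Finset.range n, if i ∈ S a then f a i else 0 := by
    ext a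
    rw [← Finset.sum_filter]
    congr 1
    ext i
    simpa using fun hi => Finset.mem_range.1 (hS.subset a hi)
  rw [h]
  exact Finset.measurable_sum _ fun i _ =>
    Measurable.ite (hS.measurableSet_mem i) (hf i) measurable_const

theorem MeasurableIdx.card {n : ℕ} {S : α → Finset ℕ} (hS : MeasurableIdx n S) :
    Measurable fun a => ((S a).card : ℝ) := by
  simpa using hS.sum (f := fun _ _ => (1 : ℝ)) fun _ => measurable_const

theorem measurable_aug (a : Fin (d + 1)) : Measurable fun z : Obs d K => z.aug a := by
  refine Fin.cases ?_ (fun a => ?_) a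
  · simp [Obs.aug]
  · exact (measurable_pi_apply a).comp measurable_fst

theorem measurable_trt : Measurable (Obs.trt : Obs d K → Fin 2) :=
  measurable_fst.comp measurable_snd

theorem measurable_out : Measurable (Obs.out : Obs d K → ℝ) :=
  measurable_fst.comp (measurable_snd.comp measurable_snd)

theorem measurable_study : Measurable (Obs.study : Obs d K → Fin K) :=
  measurable_snd.comp (measurable_snd.comp measurable_snd)

variable {z : α → ℕ → Obs d K}

theorem measurable_aug_apply (hz : Measurable z) (i : ℕ) (a : Fin (d + 1)) :
    Measurable fun x => (z x i).aug a :=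
  (measurable_aug a).comp ((measurable_pi_apply i).comp hz)

theorem measurable_out_apply (hz : Measurable z) (i : ℕ) : Measurable fun x => (z x i).out :=
  measurable_out.comp ((measurable_pi_apply i).comp hz)

theorem measurableIdx_range (n : ℕ) : MeasurableIdx n fun _ : α => Finset.range n :=
  ⟨fun _ => subset_rfl, fun i => MeasurableSet.const (i ∈ Finset.range n)⟩

theorem measurableIdx_filter (hz : Measurable z) (n : ℕ) {p : Obs d K → Prop} [DecidablePred p]
    (hp : MeasurableSet {y | p y}) :
    MeasurableIdx n fun x => (Finset.range n).filter fun i => p (z x i) := by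
  refine ⟨fun _ => Finset.filter_subset _ _, fun i => ?_⟩
  simp only [Finset.mem_filter]
  exact (MeasurableSet.const _).inter (((measurable_pi_apply i).comp hz) hp)

theorem measurableIdx_arm (hz : Measurable z) (n : ℕ) (w : Fin 2) :
    MeasurableIdx n fun x => armIdx n (z x) w :=
  measurableIdx_filter hz n (p := fun y => y.trt = w) (measurable_trt (measurableSet_singleton w))

theorem measurableIdx_study (hz : Measurable z) (n : ℕ) (k : Fin K) :
    MeasurableIdx n fun x => studyIdx n (z x) k :=
  measurableIdx_filter hz n (p := fun y => y.study = k)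
    (measurable_study (measurableSet_singleton k))

theorem measurableIdx_cell (hz : Measurable z) (n : ℕ) (k : Fin K) (w : Fin 2) :
    MeasurableIdx n fun x => cellIdx n (z x) k w :=
  measurableIdx_filter hz n (p := fun y => y.study = k ∧ y.trt = w)
    ((measurable_study (measurableSet_singleton k)).inter
      (measurable_trt (measurableSet_singleton w)))

variable {n : ℕ} {S : α → Finset ℕ}

theorem gram_apply (z : ℕ → Obs d K) (S : Finset ℕ) (a b : Fin (d + 1)) :
    gram z S a b = ∑ i ∈ S, (z i).aug a * (z i).aug b := by
  simp [gram, Matrix.sum_apply, Matrix.vecMulVec_apply]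

theorem moment_apply (z : ℕ → Obs d K) (S : Finset ℕ) (a : Fin (d + 1)) :
    moment z S a = ∑ i ∈ S, (z i).out * (z i).aug a := by
  simp [moment, Finset.sum_apply]

theorem measurable_gram (hz : Measurable z) (hS : MeasurableIdx n S) (a b : Fin (d + 1)) :
    Measurable fun x => gram (z x) (S x) a b := by
  simp only [gram_apply]
  exact hS.sum fun i => (measurable_aug_apply hz i a).mul (measurable_aug_apply hz i b)

theorem measurable_moment (hz : Measurable z) (hS : MeasurableIdx n S) (a : Fin (d + 1)) :
    Measurable fun x => moment (z x) (S x) a := by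
  simp only [moment_apply]
  exact hS.sum fun i => (measurable_out_apply hz i).mul (measurable_aug_apply hz i a)

theorem measurable_matrix_det {m : Type*} [Fintype m] [DecidableEq m] {M : α → Matrix m m ℝ}
    (hM : ∀ a b, Measurable fun x => M x a b) : Measurable fun x => (M x).det := by
  simp only [Matrix.det_apply]
  exact Finset.measurable_sum _ fun s _ =>
    (Finset.measurable_prod _ fun i _ => hM _ _).const_smul _

/-- Adjugate over determinant; since `0⁻¹ = 0`, the formula also covers singular matrices, so no
case distinction on the rank is needed. -/
theorem measurable_matrix_inv {m : Type*} [Fintype m] [DecidableEq m] {M : α → Matrix m m ℝ}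
    (hM : ∀ a b, Measurable fun x => M x a b) (a b : m) : Measurable fun x => (M x)⁻¹ a b := by
  simp only [Matrix.inv_def, Matrix.smul_apply, Ring.inverse_eq_inv', smul_eq_mul,
    Matrix.adjugate_apply]
  refine (measurable_matrix_det hM).inv.mul (measurable_matrix_det fun i j => ?_)
  by_cases h : i = b
  · subst h; simp
  · simpa [Matrix.updateRow_ne h] using hM i j

theorem measurable_matrix_mulVec {l m : Type*} [Fintype m] {M : α → Matrix l m ℝ} {v : α → m → ℝ}
    (hM : ∀ a b, Measurable fun x => M x a b) (hv : ∀ b, Measurable fun x => v x b) (a : l) :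
    Measurable fun x => (M x).mulVec (v x) a := by
  simp only [Matrix.mulVec, dotProduct]
  exact Finset.measurable_sum _ fun b _ => (hM a b).mul (hv b)

theorem measurable_dot {m : Type*} [Fintype m] {u v : α → m → ℝ}
    (hu : ∀ a, Measurable fun x => u x a) (hv : ∀ a, Measurable fun x => v x a) :
    Measurable fun x => u x ⬝ᵥ v x := by
  simp only [dotProduct]
  exact Finset.measurable_sum _ fun b _ => (hu b).mul (hv b)

theorem measurable_ols (hz : Measurable z) (hS : MeasurableIdx n S) (a : Fin (d + 1)) :
    Measurable fun x => ols (z x) (S x) a :=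
  measurable_matrix_mulVec (measurable_matrix_inv (measurable_gram hz hS))
    (measurable_moment hz hS) a

theorem measurable_gFormula (hz : Measurable z) (hS : MeasurableIdx n S)
    {θ : α → Fin 2 → Fin (d + 1) → ℝ} (hθ : ∀ w a, Measurable fun x => θ x w a) :
    Measurable fun x => gFormula (z x) (S x) (θ x) :=
  (hS.card.const_div 1).mul (hS.sum fun i =>
    (measurable_dot (measurable_aug_apply hz i) (hθ 1)).sub
      (measurable_dot (measurable_aug_apply hz i) (hθ 0)))

theorem measurable_tauPool (hz : Measurable z) (n : ℕ) : Measurable fun x => tauPool n (z x) :=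
  measurable_gFormula hz (measurableIdx_range n) fun w => measurable_ols hz (measurableIdx_arm hz n w)

theorem measurable_tauLocal (hz : Measurable z) (n : ℕ) (k : Fin K) :
    Measurable fun x => tauLocal n (z x) k :=
  measurable_gFormula hz (measurableIdx_study hz n k) fun w =>
    measurable_ols hz (measurableIdx_cell hz n k w)

theorem measurable_tauMetaSW (hz : Measurable z) (n : ℕ) : Measurable fun x => tauMetaSW n (z x) :=
  Finset.measurable_sum _ fun k _ =>
    ((measurableIdx_study hz n k).card.div_const _).mul (measurable_tauLocal hz n k)

theorem measurable_tauMetaIVW (hz : Measurable z) (n : ℕ) {v : α → Fin K → ℝ}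
    (hv : ∀ k, Measurable fun x => v x k) : Measurable fun x => tauMetaIVW (v x) n (z x) :=
  (Finset.measurable_sum _ fun k _ => (hv k).inv.mul (measurable_tauLocal hz n k)).div
    (Finset.measurable_sum _ fun k _ => (hv k).inv)

theorem measurable_aggregateSW (hz : Measurable z) (n : ℕ)
    {θ : α → Fin 2 → Fin (d + 1) → ℝ} (hθ : ∀ w a, Measurable fun x => θ x w a) :
    Measurable fun x => aggregateSW n (z x) (θ x) :=
  Finset.measurable_sum _ fun k _ => ((measurableIdx_study hz n k).card.div_const _).mul
    (measurable_gFormula hz (measurableIdx_study hz n k) hθ)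

theorem measurable_tau1SSW (hz : Measurable z) (n : ℕ) : Measurable fun x => tau1SSW n (z x) := by
  refine measurable_aggregateSW hz n fun w a => ?_
  simp only [theta1SSW, Finset.sum_apply, Pi.smul_apply, smul_eq_mul]
  exact Finset.measurable_sum _ fun k _ =>
    ((measurableIdx_cell hz n k w).card.div (measurableIdx_arm hz n w).card).mul
      (measurable_ols hz (measurableIdx_cell hz n k w) a)

theorem measurable_tau1SIVW (hz : Measurable z) (σ : ℝ) (n : ℕ) :
    Measurable fun x => tau1SIVW σ n (z x) := by
  have hp : ∀ k w a b, Measurable fun x => precision σ n (z x) k w a b := fun k w a b =>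
    (measurable_gram hz (measurableIdx_cell hz n k w) a b).const_smul (1 / σ ^ 2)
  refine measurable_aggregateSW hz n fun w a => ?_
  refine measurable_matrix_mulVec (measurable_matrix_inv fun a b => ?_) (fun a => ?_) a
  · simp only [Matrix.sum_apply]
    exact Finset.measurable_sum _ fun k _ => hp k w a b
  · simp only [Finset.sum_apply]
    exact Finset.measurable_sum _ fun k _ => measurable_matrix_mulVec (hp k w)
      (measurable_ols hz (measurableIdx_cell hz n k w)) a

theorem measurable_gradStep {η : α → ℝ} (hη : Measurable η) (hz : Measurable z)
    (hS : MeasurableIdx n S) {θ : α → Fin (d + 1) → ℝ} (hθ : Measurable θ) :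
    Measurable fun x => gradStep (η x) (z x) (S x) (θ x) := by
  refine measurable_pi_lambda _ fun a => ?_
  have hθ' : ∀ a, Measurable fun x => θ x a := fun a => (measurable_pi_apply a).comp hθ
  simp only [gradStep, Pi.sub_apply, Pi.smul_apply, smul_eq_mul, Finset.sum_apply]
  exact (hθ' a).sub (hη.mul ((hS.card.const_div 2).neg.mul (hS.sum fun i =>
    ((measurable_out_apply hz i).sub (measurable_dot (measurable_aug_apply hz i) hθ')).mul
      (measurable_aug_apply hz i a))))

theorem measurable_gradStep_iterate {η : α → ℝ} (hη : Measurable η) (hz : Measurable z)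
    (hS : MeasurableIdx n S) {θ : α → Fin (d + 1) → ℝ} (hθ : Measurable θ) (E : ℕ) :
    Measurable fun x => (gradStep (η x) (z x) (S x))^[E] (θ x) := by
  induction E with
  | zero => exact hθ
  | succ E ih =>
    simp only [Function.iterate_succ_apply']
    exact measurable_gradStep hη hz hS ih

theorem measurable_fedAvg {η : α → ℝ} (hη : Measurable η) (hz : Measurable z)
    {θ₀ : α → Fin (d + 1) → ℝ} (hθ₀ : Measurable θ₀) (E n : ℕ) (w : Fin 2) (T : ℕ) :
    Measurable fun x => fedAvg E (η x) (θ₀ x) n (z x) w T := by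
  induction T with
  | zero => exact hθ₀
  | succ T ih =>
    simp only [fedAvg, Function.iterate_succ_apply'] at ih ⊢
    refine Finset.measurable_fun_sum _ fun k _ =>
      ((measurableIdx_cell hz n k w).card.div (measurableIdx_arm hz n w).card).smul ?_
    exact measurable_gradStep_iterate hη hz (measurableIdx_cell hz n k w) ih E

theorem measurable_tauGD (hz : Measurable z) (E n : ℕ) {η : α → Fin 2 → ℝ} (hη : Measurable η)
    {θ₀ : α → Fin 2 → Fin (d + 1) → ℝ} (hθ₀ : Measurable θ₀) :
    Measurable fun x => tauGD E (η x) (θ₀ x) n (z x) := by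
  refine measurable_aggregateSW hz n fun w => measurable_pi_iff.1 ?_
  -- This needs no convergence: where the limit does not exist, `limUnder` takes a fixed value.
  exact (StronglyMeasurable.limUnder fun T => (measurable_fedAvg ((measurable_pi_apply w).comp hη) hz
    ((measurable_pi_apply w).comp hθ₀) E n w T).stronglyMeasurable).measurable

theorem measurableSet_localFullRank (hz : Measurable z) (n : ℕ) :
    MeasurableSet {x | LocalFullRank n (z x)} := by
  simp only [LocalFullRank, isUnit_iff_ne_zero, Set.ofPred_forall]
  exact MeasurableSet.iInter fun k => MeasurableSet.iInter fun w =>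
    (measurable_matrix_det (measurable_gram hz (measurableIdx_cell hz n k w)))
      (measurableSet_singleton 0).compl

end Measurability

/-! ### Consequences of a constant conditional variance. -/

section CondVariance

variable {Ω : Type*} {m m₀ : MeasurableSpace Ω} {P : Measure[m₀] Ω} [IsProbabilityMeasure P]

/-- If the conditional second moment of `e` is constant, then `e * f` is square integrable for
every square integrable `f` that is measurable with respect to the conditioning `σ`-algebra. -/
theorem memLp_mul_of_condExp_sq_eq_const (hm : m ≤ m₀) {e f : Ω → ℝ} {s : ℝ}
    (hem : Measurable e) (he : MemLp e 2 P) (hs : P[e ^ 2 | m] =ᵐ[P] fun _ => s)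
    (hfm : Measurable[m] f) (hf : MemLp f 2 P) : MemLp (fun ω => e ω * f ω) 2 P := by
  have hint : Integrable (e ^ 2) P := he.integrable_sq
  have hg : Measurable[m₀] fun ω => ENNReal.ofReal (e ω ^ 2) :=
    ENNReal.measurable_ofReal.comp (hem.pow_const 2)
  -- On `m`-measurable sets the measure `e² P` is `s P`, hence `∫ e² f² = s ∫ f²` in `[0, ∞]`.
  -- Working with measures avoids presupposing that `e² f²` is integrable, as pulling `f²` out of a
  -- conditional expectation would.
  have hμ : (P.withDensity fun ω => ENNReal.ofReal (e ω ^ 2)).trim hm =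
      ENNReal.ofReal s • P.trim hm := by
    refine @Measure.ext _ m _ _ fun A hA => ?_
    rw [trim_measurableSet_eq hm hA, Measure.smul_apply, trim_measurableSet_eq hm hA,
      withDensity_apply _ (hm A hA)]
    rw [← ofReal_integral_eq_lintegral_ofReal (f := fun ω => e ω ^ 2) (hint.restrict (s := A))
      (ae_of_all _ fun ω => sq_nonneg (e ω))]
    have h1 : ∫ ω in A, e ω ^ 2 ∂P = s * P.real A := by
      have h2 := setIntegral_condExp hm hint hA
      rw [setIntegral_congr_ae (hm A hA) (hs.mono fun ω hω _ => hω)] at h2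
      simp only [Pi.pow_apply] at h2
      rw [← h2]
      simp [mul_comm]
    have h3 : 0 ≤ s := by
      have h4 : ∫ ω, (P[e ^ 2 | m]) ω ∂P = ∫ ω, (e ^ 2) ω ∂P := integral_condExp hm
      rw [integral_congr_ae hs] at h4
      simp only [integral_const, probReal_univ, one_smul] at h4
      rw [h4]
      exact integral_nonneg fun ω => sq_nonneg (e ω)
    simp only [h1, smul_eq_mul]
    rw [ENNReal.ofReal_mul h3, ofReal_measureReal]
  have hmeas : Measurable fun ω => e ω * f ω := hem.mul (hfm.mono hm le_rfl)
  rw [memLp_two_iff_integrable_sq hmeas.aestronglyMeasurable]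
  refine ⟨(hmeas.pow_const 2).aestronglyMeasurable, ?_⟩
  rw [hasFiniteIntegral_iff_ofReal (ae_of_all _ fun ω => sq_nonneg _)]
  have hf2 := (hf.integrable_sq).2
  rw [hasFiniteIntegral_iff_ofReal (ae_of_all _ fun ω => sq_nonneg _)] at hf2
  have hfm2 : Measurable[m] fun ω => ENNReal.ofReal (f ω ^ 2) := (hfm.pow_const 2).ennreal_ofReal
  calc ∫⁻ ω, ENNReal.ofReal ((e ω * f ω) ^ 2) ∂P
      = ∫⁻ ω, ENNReal.ofReal (f ω ^ 2) ∂(P.withDensity fun ω => ENNReal.ofReal (e ω ^ 2)) := by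
        rw [lintegral_withDensity_eq_lintegral_mul _ hg (hfm2.mono hm le_rfl)]
        refine lintegral_congr fun ω => ?_
        rw [mul_pow, ENNReal.ofReal_mul (sq_nonneg _), Pi.mul_apply]
    _ = ENNReal.ofReal s * ∫⁻ ω, ENNReal.ofReal (f ω ^ 2) ∂P := by
        rw [← lintegral_trim hm hfm2, hμ, lintegral_smul_measure, lintegral_trim hm hfm2,
          smul_eq_mul]
    _ < ⊤ := ENNReal.mul_lt_top ENNReal.ofReal_lt_top hf2

/-- A variable with zero conditional mean is orthogonal to the conditioning variables. -/
theorem integral_mul_eq_zero_of_condExp_eq_zero (hm : m ≤ m₀) {e f : Ω → ℝ}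
    (he : MemLp e 2 P) (h0 : P[e | m] =ᵐ[P] fun _ => 0)
    (hfm : Measurable[m] f) (hf : MemLp f 2 P) : ∫ ω, e ω * f ω ∂P = 0 := by
  have hef : Integrable (e * f) P := he.integrable_mul hf
  have h1 := condExp_mul_of_stronglyMeasurable_right hfm.stronglyMeasurable hef
    (he.integrable (by norm_num))
  have h2 : ∫ ω, (P[e * f | m]) ω ∂P = ∫ ω, (e * f) ω ∂P := integral_condExp hm
  rw [integral_congr_ae (g := fun _ => (0 : ℝ))
    (by filter_upwards [h1, h0] with ω h h'; simp [h, h'])] at h2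
  simpa using h2.symm

end CondVariance

/-! ### Moments in the model: cells, residuals, and the second moment matrix of `(1, X)`. -/

section Model

variable {Ω : Type*} [MeasurableSpace Ω] {P : Measure Ω} [IsProbabilityMeasure P]
  {d K : ℕ} {X : ℕ → Ω → Fin d → ℝ} {W : ℕ → Ω → Fin 2} {H : ℕ → Ω → Fin K}
  {Y : Fin 2 → ℕ → Ω → ℝ} {ρ prob : Fin K → ℝ} {c : Fin 2 → ℝ} {β : Fin 2 → Fin d → ℝ} {σ : ℝ}

/-- The probability of receiving treatment `w` in study `k`. -/
def armProb (prob : Fin K → ℝ) (k : Fin K) (w : Fin 2) : ℝ :=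
  if w = 1 then prob k else 1 - prob k

/-- The covariance matrix bordered by the means: the second moment matrix of `(1, X)`. -/
def augMoment (P : Measure Ω) (V : Ω → Fin d → ℝ) : Matrix (Fin (d + 1)) (Fin (d + 1)) ℝ :=
  Matrix.of fun a b =>
    ∫ ω, (Matrix.vecCons 1 (V ω) : Fin (d + 1) → ℝ) a *
      (Matrix.vecCons 1 (V ω) : Fin (d + 1) → ℝ) b ∂P

namespace HomogeneousModel

omit [IsProbabilityMeasure P] in
theorem measurable_obs (hM : HomogeneousModel P X W H Y ρ prob c β σ) (i : ℕ) :
    Measurable (obs X W H Y i) := by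
  refine (hM.measurable_X i).prodMk ((hM.measurable_W i).prodMk
    (Measurable.prodMk ?_ (hM.measurable_H i)))
  have : (fun ω => Y (W i ω) i ω) = fun ω => if W i ω = 1 then Y 1 i ω else Y 0 i ω := by
    ext ω
    split_ifs with h
    · rw [h]
    · rw [show W i ω = 0 by omega]
  rw [this]
  exact Measurable.ite (hM.measurable_W i (measurableSet_singleton 1)) (hM.measurable_Y 1 i)
    (hM.measurable_Y 0 i)

omit [IsProbabilityMeasure P] in
theorem measurable_sample (hM : HomogeneousModel P X W H Y ρ prob c β σ) :
    Measurable fun ω i => obs X W H Y i ω :=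
  measurable_pi_lambda _ hM.measurable_obs

omit [IsProbabilityMeasure P] in
theorem armProb_pos (hM : HomogeneousModel P X W H Y ρ prob c β σ) (k : Fin K) (w : Fin 2) :
    0 < armProb prob k w := by
  unfold armProb
  split_ifs
  · exact hM.treat_pos k
  · linarith [hM.treat_lt_one k]

theorem measureReal_cell (hM : HomogeneousModel P X W H Y ρ prob c β σ) (k : Fin K) (w : Fin 2) :
    P.real {ω | H 0 ω = k ∧ W 0 ω = w} = ρ k * armProb prob k w := by
  have hHk : MeasurableSet {ω | H 0 ω = k} := hM.measurable_H 0 (measurableSet_singleton k)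
  have hW1 : MeasurableSet {ω | W 0 ω = 1} := hM.measurable_W 0 (measurableSet_singleton 1)
  have h1 : P.real ({ω | H 0 ω = k} ∩ {ω | W 0 ω = 1}) = ρ k * prob k := by
    have h := hM.treat_prob 0 k
    rw [measureReal_def, cond_apply hHk, ENNReal.toReal_mul, ENNReal.toReal_inv,
      ← measureReal_def, ← measureReal_def, hM.study_prob 0 k] at h
    rw [← h, ← mul_assoc, mul_inv_cancel₀ (hM.study_pos k).ne', one_mul]
  unfold armProb
  split_ifs with hw
  · subst hw; exact h1
  · have h2 := measureReal_inter_add_sdiff (μ := P) (s := {ω | H 0 ω = k}) hW1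
    rw [h1, hM.study_prob 0 k] at h2
    have h3 : {ω | H 0 ω = k ∧ W 0 ω = w} = {ω | H 0 ω = k} \ {ω | W 0 ω = 1} := by
      ext ω
      simp only [Set.mem_ofPred_eq, Set.mem_sdiff]
      refine and_congr_right fun _ => ?_
      omega
    rw [h3]
    linarith

theorem sum_study_prob (hM : HomogeneousModel P X W H Y ρ prob c β σ) : ∑ k, ρ k = 1 := by
  have h := measureReal_biUnion_finset (μ := P) (s := (Finset.univ : Finset (Fin K)))
    (f := fun k => {ω | H 0 ω = k})
    (fun i _ j _ hij => Set.disjoint_left.2 fun ω (h1 : _ = _) (h2 : _ = _) =>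
      hij (h1.symm.trans h2))
    (fun k _ => hM.measurable_H 0 (measurableSet_singleton k))
  rw [show (⋃ k ∈ (Finset.univ : Finset (Fin K)), {ω | H 0 ω = k}) = Set.univ by ext; simp] at h
  simpa [hM.study_prob 0] using h.symm

/-- Expectations over a cell factorize, by randomization. -/
theorem integral_cell (hM : HomogeneousModel P X W H Y ρ prob c β σ) (k : Fin K) (w : Fin 2)
    {g : (Fin d → ℝ) → ℝ → ℝ} (hg : Measurable fun q : (Fin d → ℝ) × ℝ => g q.1 q.2) :
    ∫ ω, (if (obs X W H Y 0 ω).study = k ∧ (obs X W H Y 0 ω).trt = w then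
        g (obs X W H Y 0 ω).1 (obs X W H Y 0 ω).out else 0) ∂P =
      ρ k * armProb prob k w * ∫ ω, g (X 0 ω) (Y w 0 ω) ∂P := by
  have hind := (hM.randomized w 0).comp (φ := fun q => g q.1 q.2)
    (ψ := fun q : Fin 2 × Fin K => if q.2 = k ∧ q.1 = w then (1 : ℝ) else 0) hg
    (measurable_of_countable _)
  have hm1 : Measurable fun ω => g (X 0 ω) (Y w 0 ω) :=
    hg.comp ((hM.measurable_X 0).prodMk (hM.measurable_Y w 0))
  have hs : MeasurableSet {ω | H 0 ω = k ∧ W 0 ω = w} :=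
    (hM.measurable_H 0 (measurableSet_singleton k)).inter
      (hM.measurable_W 0 (measurableSet_singleton w))
  have hm2 : Measurable fun ω => if H 0 ω = k ∧ W 0 ω = w then (1 : ℝ) else 0 :=
    Measurable.ite hs measurable_const measurable_const
  have h := hind.integral_fun_mul_eq_mul_integral hm1.aestronglyMeasurable hm2.aestronglyMeasurable
  have h2 : ∫ ω, (if H 0 ω = k ∧ W 0 ω = w then (1 : ℝ) else 0) ∂P =
      ρ k * armProb prob k w := by
    rw [← hM.measureReal_cell k w, ← integral_indicator_one hs]
    refine integral_congr_ae (ae_of_all _ fun ω => ?_)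
    simp [Set.indicator_apply]
  simp only [Function.comp_def] at h
  rw [h2] at h
  rw [mul_comm, ← h]
  refine integral_congr_ae (ae_of_all _ fun ω => ?_)
  by_cases hc : H 0 ω = k ∧ W 0 ω = w
  · have hc' : (obs X W H Y 0 ω).study = k ∧ (obs X W H Y 0 ω).trt = w := hc
    simp only [if_pos hc, if_pos hc', mul_one]
    -- Inside the cell the observed outcome is the potential outcome of arm `w`.
    change g (X 0 ω) (Y (W 0 ω) 0 ω) = _
    rw [hc.2]
  · have hc' : ¬((obs X W H Y 0 ω).study = k ∧ (obs X W H Y 0 ω).trt = w) := hc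
    simp only [if_neg hc, if_neg hc', mul_zero]

omit [IsProbabilityMeasure P] in
theorem memLp_X_apply (hM : HomogeneousModel P X W H Y ρ prob c β σ) (a : Fin d) :
    MemLp (fun ω => X 0 ω a) 2 P :=
  memLp_pi_iff.1 (hM.memLp_X 0) a

omit [IsProbabilityMeasure P] in
theorem memLp_dot (hM : HomogeneousModel P X W H Y ρ prob c β σ) (u : Fin d → ℝ) :
    MemLp (fun ω => X 0 ω ⬝ᵥ u) 2 P :=
  memLp_finsetSum _ fun a _ => (hM.memLp_X_apply a).mul_const _

omit [IsProbabilityMeasure P] in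
theorem measurable_resid (hM : HomogeneousModel P X W H Y ρ prob c β σ) (w : Fin 2) (i : ℕ) :
    Measurable (resid X Y c β w i) :=
  (hM.measurable_Y w i).sub (measurable_const.add
    (measurable_dot (fun a => (measurable_pi_apply a).comp (hM.measurable_X i))
      fun _ => measurable_const))

theorem memLp_resid (hM : HomogeneousModel P X W H Y ρ prob c β σ) (w : Fin 2) :
    MemLp (resid X Y c β w 0) 2 P :=
  (hM.memLp_Y w 0).sub ((memLp_const (c w)).add (hM.memLp_dot (β w)))

-- The conditional variance is centered at the conditional mean, which vanishes almost surely.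
omit [IsProbabilityMeasure P] in
theorem condExp_resid_sq (hM : HomogeneousModel P X W H Y ρ prob c β σ) (w : Fin 2) :
    P[resid X Y c β w 0 ^ 2 | MeasurableSpace.comap (X 0) inferInstance] =ᵐ[P]
      fun _ => σ ^ 2 := by
  refine EventuallyEq.trans ?_ (hM.resid_var w 0)
  refine condExp_congr_ae ?_
  filter_upwards [hM.resid_mean w 0] with ω hω
  simp [hω]

theorem integral_resid_sq (hM : HomogeneousModel P X W H Y ρ prob c β σ) (w : Fin 2) :
    ∫ ω, resid X Y c β w 0 ω ^ 2 ∂P = σ ^ 2 := by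
  have h : ∫ ω, (P[resid X Y c β w 0 ^ 2 | MeasurableSpace.comap (X 0) inferInstance]) ω ∂P =
      ∫ ω, (resid X Y c β w 0 ^ 2) ω ∂P := integral_condExp (hM.measurable_X 0).comap_le
  rw [integral_congr_ae (hM.condExp_resid_sq w)] at h
  simpa using h.symm

/-- This puts the scores in `L²`, as the central limit theorem requires, although `X` and the
residual have only second moments. -/
theorem memLp_resid_mul (hM : HomogeneousModel P X W H Y ρ prob c β σ) (w : Fin 2)
    {f : (Fin d → ℝ) → ℝ} (hf : Measurable f) (hL : MemLp (fun ω => f (X 0 ω)) 2 P) :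
    MemLp (fun ω => resid X Y c β w 0 ω * f (X 0 ω)) 2 P :=
  memLp_mul_of_condExp_sq_eq_const (hM.measurable_X 0).comap_le (hM.measurable_resid w 0)
    (hM.memLp_resid w) (hM.condExp_resid_sq w) (hf.comp (comap_measurable _)) hL

theorem integral_resid_mul (hM : HomogeneousModel P X W H Y ρ prob c β σ) (w : Fin 2)
    {f : (Fin d → ℝ) → ℝ} (hf : Measurable f) (hL : MemLp (fun ω => f (X 0 ω)) 2 P) :
    ∫ ω, resid X Y c β w 0 ω * f (X 0 ω) ∂P = 0 :=
  integral_mul_eq_zero_of_condExp_eq_zero (hM.measurable_X 0).comap_le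
    (hM.memLp_resid w) (hM.resid_mean w 0) (hf.comp (comap_measurable _)) hL

theorem integral_resid (hM : HomogeneousModel P X W H Y ρ prob c β σ) (w : Fin 2) :
    ∫ ω, resid X Y c β w 0 ω ∂P = 0 := by
  simpa using hM.integral_resid_mul w (f := fun _ => 1) measurable_const (memLp_const _)

theorem integral_dot (hM : HomogeneousModel P X W H Y ρ prob c β σ) (u : Fin d → ℝ) :
    ∫ ω, X 0 ω ⬝ᵥ u ∂P = (fun a => ∫ ω, X 0 ω a ∂P) ⬝ᵥ u := by
  simp only [dotProduct]
  rw [integral_finsetSum _ fun a _ => ((hM.memLp_X_apply a).integrable (by norm_num)).mul_const _]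
  simp [integral_mul_const]

theorem ate_eq (hM : HomogeneousModel P X W H Y ρ prob c β σ) :
    ate P Y = c 1 - c 0 + (fun a => ∫ ω, X 0 ω a ∂P) ⬝ᵥ (β 1 - β 0) := by
  have hw : ∀ w, ∫ ω, Y w 0 ω ∂P = c w + (fun a => ∫ ω, X 0 ω a ∂P) ⬝ᵥ β w := by
    intro w
    have h := hM.integral_resid w
    have hi : Integrable (fun ω => X 0 ω ⬝ᵥ β w) P := (hM.memLp_dot _).integrable (by norm_num)
    simp only [resid] at h
    have hi' : Integrable (fun ω => c w + X 0 ω ⬝ᵥ β w) P := (integrable_const _).add hi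
    rw [integral_sub ((hM.memLp_Y w 0).integrable (by norm_num)) hi', integral_add (integrable_const _) hi, hM.integral_dot] at h
    simp only [integral_const, probReal_univ, one_smul] at h
    linarith
  rw [ate, integral_sub ((hM.memLp_Y 1 0).integrable (by norm_num))
    ((hM.memLp_Y 0 0).integrable (by norm_num)), hw, hw, dotProduct_sub]
  ring

theorem integral_sq_centered_dot (hM : HomogeneousModel P X W H Y ρ prob c β σ)
    (u : Fin d → ℝ) :
    ∫ ω, (X 0 ω ⬝ᵥ u - (fun a => ∫ ω, X 0 ω a ∂P) ⬝ᵥ u) ^ 2 ∂P =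
      u ⬝ᵥ (covMatrix P (X 0)).mulVec u := by
  rw [← hM.integral_dot, ← variance_eq_integral (hM.memLp_dot u).aestronglyMeasurable.aemeasurable,
    ← covariance_self (hM.memLp_dot u).aestronglyMeasurable.aemeasurable]
  simp only [dotProduct]
  rw [covariance_fun_sum_fun_sum (fun a => (hM.memLp_X_apply a).mul_const _)
    (fun a => (hM.memLp_X_apply a).mul_const _)]
  simp only [covariance_mul_const_left, covariance_mul_const_right, Matrix.mulVec, dotProduct,
    covMatrix, Matrix.of_apply, Finset.mul_sum]
  exact Finset.sum_congr rfl fun a _ => Finset.sum_congr rfl fun b _ => by ring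

/-- The Schur complement of the entry `1` in the corner is the covariance matrix. For a kernel
vector `v`, row `0` gives `v 0` in terms of the other entries; eliminating it leaves the covariance
matrix applied to those entries, so they vanish and then `v 0` does. -/
theorem isUnit_det_augMoment (hM : HomogeneousModel P X W H Y ρ prob c β σ) :
    IsUnit (augMoment P (X 0)).det := by
  rw [← Matrix.isUnit_iff_isUnit_det, ← Matrix.mulVec_injective_iff_isUnit]
  refine (injective_iff_map_eq_zero (Matrix.mulVecLin (augMoment P (X 0)))).2 fun v hv => ?_
  replace hv : (augMoment P (X 0)).mulVec v = 0 := hv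
  set μ : Fin d → ℝ := fun a => ∫ ω, X 0 ω a ∂P with hμ
  have h0 : v 0 + ∑ b, μ b * v b.succ = 0 := by
    have := congrFun hv 0
    simpa [Matrix.mulVec, dotProduct, Fin.sum_univ_succ, augMoment] using this
  have hcov : ∀ a b, ∫ ω, X 0 ω a * X 0 ω b ∂P = covMatrix P (X 0) a b + μ a * μ b := by
    intro a b
    have := covariance_eq_sub (hM.memLp_X_apply a) (hM.memLp_X_apply b)
    simp only [covMatrix, Matrix.of_apply, this, hμ]
    simp
  have hS : (covMatrix P (X 0)).mulVec (fun b => v b.succ) = 0 := by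
    ext a
    have := congrFun hv a.succ
    simp only [Matrix.mulVec, dotProduct, Fin.sum_univ_succ, augMoment, Matrix.of_apply,
      Matrix.cons_val_succ, Matrix.cons_val_zero, mul_one, hcov, Pi.zero_apply, add_mul,
      Finset.sum_add_distrib] at this
    have h2 : ∑ b, μ a * μ b * v b.succ = μ a * ∑ b, μ b * v b.succ := by
      rw [Finset.mul_sum]
      exact Finset.sum_congr rfl fun b _ => by ring
    rw [h2] at this
    simp only [Matrix.mulVec, dotProduct, Pi.zero_apply]
    have h3 : ∫ ω, X 0 ω a ∂P = μ a := rfl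
    rw [h3] at this
    linear_combination this - μ a * h0
  have hsucc : (fun b : Fin d => v b.succ) = 0 := by
    have hu := (Matrix.isUnit_iff_isUnit_det _).1 hM.cov_posDef.isUnit
    exact Matrix.eq_zero_of_mulVec_eq_zero hu.ne_zero hS
  have hz : v 0 = 0 := by
    have : ∀ b : Fin d, v b.succ = 0 := fun b => congrFun hsucc b
    simpa [this] using h0
  ext a
  refine Fin.cases hz (fun b => congrFun hsucc b) a

end HomogeneousModel

end Model

/-! ### Exact finite-sample identities for OLS, G-formulas and Gram matrices. -/

section Algebra

variable {d K : ℕ}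

theorem aug_zero (z : Obs d K) : z.aug 0 = 1 := rfl

/-- The sum over `S` of the scores `(y_i - x'_i θ) x'_i`. -/
def score (z : ℕ → Obs d K) (S : Finset ℕ) (θ : Fin (d + 1) → ℝ) : Fin (d + 1) → ℝ :=
  ∑ i ∈ S, ((z i).out - (z i).aug ⬝ᵥ θ) • (z i).aug

/-- The average of the augmented covariates over `S`. -/
def augMean (z : ℕ → Obs d K) (S : Finset ℕ) : Fin (d + 1) → ℝ :=
  (S.card : ℝ)⁻¹ • gram z S 0

theorem gram_zero_zero (z : ℕ → Obs d K) (S : Finset ℕ) : gram z S 0 0 = S.card := by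
  simp [gram_apply, aug_zero]

theorem gram_mulVec (z : ℕ → Obs d K) (S : Finset ℕ) (θ : Fin (d + 1) → ℝ) :
    (gram z S).mulVec θ = ∑ i ∈ S, ((z i).aug ⬝ᵥ θ) • (z i).aug := by
  rw [gram, Matrix.sum_mulVec]
  refine Finset.sum_congr rfl fun i _ => ?_
  rw [Matrix.vecMulVec_mulVec]
  ext a
  simp [mul_comm]

theorem score_eq (z : ℕ → Obs d K) (S : Finset ℕ) (θ : Fin (d + 1) → ℝ) :
    score z S θ = moment z S - (gram z S).mulVec θ := by
  rw [gram_mulVec, score, moment, ← Finset.sum_sub_distrib]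
  simp [sub_smul]

theorem ols_sub (z : ℕ → Obs d K) {S : Finset ℕ} (hS : IsUnit (gram z S).det)
    (θ : Fin (d + 1) → ℝ) : ols z S - θ = (gram z S)⁻¹.mulVec (score z S θ) := by
  rw [score_eq, Matrix.mulVec_sub, Matrix.mulVec_mulVec, Matrix.nonsing_inv_mul _ hS,
    Matrix.one_mulVec, ols]

theorem card_ne_zero_of_isUnit_det {z : ℕ → Obs d K} {S : Finset ℕ}
    (hS : IsUnit (gram z S).det) : S.card ≠ 0 := by
  intro h
  rw [Finset.card_eq_zero.1 h] at hS
  simp [gram, Matrix.det_zero] at hS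

/-- Row `0` of the Gram matrix is the sum of the `x'_i`, because their entry `0` is one. -/
theorem gFormula_eq (z : ℕ → Obs d K) (S : Finset ℕ) (θ : Fin 2 → Fin (d + 1) → ℝ) :
    gFormula z S θ = augMean z S ⬝ᵥ (θ 1 - θ 0) := by
  have h : gram z S 0 = ∑ i ∈ S, (z i).aug := by
    ext a
    simp [gram_apply, aug_zero, Finset.sum_apply]
  rw [gFormula, augMean, smul_dotProduct, h, sum_dotProduct, one_div, smul_eq_mul]
  simp [dotProduct_sub]

/-- The parameters `(c, β)` of the linear outcome models. -/
def coef (c : Fin 2 → ℝ) (β : Fin 2 → Fin d → ℝ) (w : Fin 2) : Fin (d + 1) → ℝ :=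
  Matrix.vecCons (c w) (β w)

theorem aug_dot_coef (z : Obs d K) (c : Fin 2 → ℝ) (β : Fin 2 → Fin d → ℝ) (w : Fin 2) :
    z.aug ⬝ᵥ coef c β w = c w + z.1 ⬝ᵥ β w := by
  simp [Obs.aug, coef]

/-- The error of a plug-in G-formula. -/
theorem gFormula_sub (z : ℕ → Obs d K) {S : Finset ℕ} (hS : S.card ≠ 0)
    (θ : Fin 2 → Fin (d + 1) → ℝ) (c : Fin 2 → ℝ) (β : Fin 2 → Fin d → ℝ) (m : ℝ) :
    gFormula z S θ - (c 1 - c 0 + m) =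
      (S.card : ℝ)⁻¹ * ∑ i ∈ S, ((z i).1 ⬝ᵥ (β 1 - β 0) - m) +
        ∑ w : Fin 2, (if w = 1 then 1 else -1) * (augMean z S ⬝ᵥ (θ w - coef c β w)) := by
  have h1 := gFormula_eq z S (coef c β)
  have h2 : gFormula z S (coef c β) =
      (c 1 - c 0 + m) + (S.card : ℝ)⁻¹ * ∑ i ∈ S, ((z i).1 ⬝ᵥ (β 1 - β 0) - m) := by
    have h3 : ∀ i ∈ S, (z i).aug ⬝ᵥ coef c β 1 - (z i).aug ⬝ᵥ coef c β 0 =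
        (c 1 - c 0 + m) + ((z i).1 ⬝ᵥ (β 1 - β 0) - m) := by
      intro i _
      rw [aug_dot_coef, aug_dot_coef, dotProduct_sub]
      ring
    rw [gFormula, Finset.sum_congr rfl h3, Finset.sum_add_distrib, one_div, mul_add]
    congr 1
    have : (S.card : ℝ) ≠ 0 := Nat.cast_ne_zero.2 hS
    rw [Finset.sum_const, nsmul_eq_mul, inv_mul_cancel_left₀ this]
  rw [gFormula_eq, Fin.sum_univ_two]
  simp only [dotProduct_sub (augMean z S)] at h1 ⊢
  simp only [zero_ne_one, if_false, if_true]
  linarith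

variable (n : ℕ) (z : ℕ → Obs d K)

theorem sum_studyIdx {M : Type*} [AddCommMonoid M] (k : Fin K) (f : ℕ → M) :
    ∑ i ∈ studyIdx n z k, f i = ∑ w, ∑ i ∈ cellIdx n z k w, f i := by
  rw [studyIdx, ← Finset.sum_fiberwise _ (fun i => (z i).trt)]
  simp only [cellIdx, Finset.filter_filter]

theorem sum_armIdx {M : Type*} [AddCommMonoid M] (w : Fin 2) (f : ℕ → M) :
    ∑ i ∈ armIdx n z w, f i = ∑ k, ∑ i ∈ cellIdx n z k w, f i := by
  rw [armIdx, ← Finset.sum_fiberwise _ (fun i => (z i).study)]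
  simp only [cellIdx, Finset.filter_filter, and_comm]

theorem sum_range_eq {M : Type*} [AddCommMonoid M] (f : ℕ → M) :
    ∑ i ∈ Finset.range n, f i = ∑ k, ∑ i ∈ studyIdx n z k, f i := by
  rw [← Finset.sum_fiberwise _ (fun i => (z i).study)]
  rfl

theorem sum_card_cellIdx (w : Fin 2) :
    ∑ k, ((cellIdx n z k w).card : ℝ) = (armIdx n z w).card := by
  simpa using (sum_armIdx n z w (fun _ => (1 : ℝ))).symm

theorem sum_card_studyIdx : ∑ k, ((studyIdx n z k).card : ℝ) = n := by
  simpa using (sum_range_eq n z (fun _ => (1 : ℝ))).symm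

/-- The sizes `n_k` cancel and an empty study contributes zero on both sides. Federated estimators
thus differ from the pooled one only through their parameters. -/
theorem aggregateSW_eq (θ : Fin 2 → Fin (d + 1) → ℝ) :
    aggregateSW n z θ = gFormula z (Finset.range n) θ := by
  rw [gFormula, sum_range_eq n z, aggregateSW, Finset.mul_sum]
  refine Finset.sum_congr rfl fun k _ => ?_
  rcases eq_or_ne (studyIdx n z k).card 0 with h | h
  · rw [Finset.card_eq_zero.1 h]; simp
  · have : ((studyIdx n z k).card : ℝ) ≠ 0 := Nat.cast_ne_zero.2 h
    rw [gFormula, Finset.card_range]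
    field_simp

theorem posSemidef_gram (S : Finset ℕ) : (gram z S).PosSemidef := by
  refine Matrix.posSemidef_sum _ fun i _ => ?_
  simpa using Matrix.posSemidef_vecMulVec_self_star (z i).aug

theorem posDef_gram_iff (S : Finset ℕ) : (gram z S).PosDef ↔ IsUnit (gram z S).det := by
  rw [← Matrix.isUnit_iff_isUnit_det]
  exact (posSemidef_gram z S).posDef_iff_isUnit

theorem gram_armIdx (w : Fin 2) : gram z (armIdx n z w) = ∑ k, gram z (cellIdx n z k w) :=
  sum_armIdx n z w _

theorem gram_studyIdx (k : Fin K) : gram z (studyIdx n z k) = ∑ w, gram z (cellIdx n z k w) :=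
  sum_studyIdx n z k _

variable {n z}

/-- Gram matrices are positive semidefinite, so the invertible ones are positive definite, a
property that a nonempty sum keeps. -/
theorem LocalFullRank.federated (hK : 0 < K) (h : LocalFullRank n z) : FederatedFullRank n z := by
  intro w
  have : Nonempty (Fin K) := ⟨⟨0, hK⟩⟩
  rw [← posDef_gram_iff, gram_armIdx]
  exact Matrix.posDef_sum Finset.univ_nonempty fun k _ => (posDef_gram_iff z _).2 (h k w)

theorem LocalFullRank.card_studyIdx_ne_zero (h : LocalFullRank n z) (k : Fin K) :
    (studyIdx n z k).card ≠ 0 := by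
  intro h0
  refine card_ne_zero_of_isUnit_det (h k 0) ?_
  rw [Finset.card_eq_zero] at h0 ⊢
  rw [← Finset.subset_empty, ← h0]
  exact Finset.monotone_filter_right _ fun i _ hi => hi.1

theorem LocalFullRank.ne_zero (hK : 0 < K) (h : LocalFullRank n z) : n ≠ 0 := by
  rintro rfl
  exact h.card_studyIdx_ne_zero ⟨0, hK⟩ (by simp [studyIdx])

end Algebra

/-! ### Limits of Gram matrices and of the coefficients of the scores. -/

section GramLimit

variable {d K : ℕ}

/-- The Gram matrices of the subsamples `S n`, divided by `n`, converge to `q M`. -/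
def GramLimit (z : ℕ → Obs d K) (S : ℕ → Finset ℕ) (q : ℝ)
    (M : Matrix (Fin (d + 1)) (Fin (d + 1)) ℝ) : Prop :=
  Tendsto (fun n : ℕ => (n : ℝ)⁻¹ • gram z (S n)) atTop (𝓝 (q • M))

variable {z : ℕ → Obs d K} {S : ℕ → Finset ℕ} {q : ℝ}
  {M : Matrix (Fin (d + 1)) (Fin (d + 1)) ℝ}

theorem GramLimit.tendsto_row (h : GramLimit z S q M) :
    Tendsto (fun n : ℕ => (n : ℝ)⁻¹ • gram z (S n) 0) atTop (𝓝 (q • M 0)) :=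
  tendsto_pi_nhds.1 h 0

theorem GramLimit.tendsto_card (h : GramLimit z S q M) (hM : M 0 0 = 1) :
    Tendsto (fun n : ℕ => ((S n).card : ℝ) / n) atTop (𝓝 q) := by
  have := tendsto_pi_nhds.1 h.tendsto_row 0
  simpa [gram_zero_zero, hM, div_eq_inv_mul] using this

/-- The proportion `q` cancels: all subsamples share the limit `M 0`, as the population is
homogeneous. -/
theorem GramLimit.tendsto_augMean (h : GramLimit z S q M) (hM : M 0 0 = 1) (hq : 0 < q) :
    Tendsto (fun n : ℕ => augMean z (S n)) atTop (𝓝 (M 0)) := by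
  have h1 := ((h.tendsto_card hM).inv₀ hq.ne').smul h.tendsto_row
  rw [smul_smul, inv_mul_cancel₀ hq.ne', one_smul] at h1
  refine h1.congr' ?_
  filter_upwards [eventually_ne_atTop 0] with n hn
  have : (n : ℝ) ≠ 0 := Nat.cast_ne_zero.2 hn
  rw [augMean, smul_smul, inv_div, div_mul_eq_mul_div, mul_inv_cancel₀ this, one_div]

theorem GramLimit.eventually_isUnit_det (h : GramLimit z S q M) (hM : IsUnit M.det) (hq : 0 < q) :
    ∀ᶠ n in atTop, IsUnit (gram z (S n)).det := by
  have hd : Tendsto (fun n : ℕ => ((n : ℝ)⁻¹ • gram z (S n)).det) atTop (𝓝 (q • M).det) :=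
    (Continuous.matrix_det continuous_id).continuousAt.tendsto.comp h
  have hne : (q • M).det ≠ 0 := by
    rw [Matrix.det_smul]
    exact mul_ne_zero (pow_ne_zero _ hq.ne') hM.ne_zero
  filter_upwards [hd.eventually_ne hne] with n hn
  rw [Matrix.det_smul] at hn
  exact isUnit_iff_ne_zero.2 (right_ne_zero_of_mul hn)

theorem inv_smul_of_ne_zero {m : Type*} [Fintype m] [DecidableEq m] {A : Matrix m m ℝ}
    (hA : IsUnit A.det) {r : ℝ} (hr : r ≠ 0) : (r • A)⁻¹ = r⁻¹ • A⁻¹ := by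
  refine Matrix.inv_eq_left_inv ?_
  rw [Matrix.smul_mul, Matrix.mul_smul, smul_smul, inv_mul_cancel₀ hr, one_smul,
    Matrix.nonsing_inv_mul _ hA]

theorem GramLimit.tendsto_inv (h : GramLimit z S q M) (hM : IsUnit M.det) (hq : 0 < q) :
    Tendsto (fun n : ℕ => (n : ℝ) • (gram z (S n))⁻¹) atTop (𝓝 (q⁻¹ • M⁻¹)) := by
  have hne : (q • M).det ≠ 0 := by
    rw [Matrix.det_smul]
    exact mul_ne_zero (pow_ne_zero _ hq.ne') hM.ne_zero
  have hinv : Tendsto (fun n : ℕ => ((n : ℝ)⁻¹ • gram z (S n))⁻¹) atTop (𝓝 (q • M)⁻¹) := by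
    have hc : ContinuousAt (fun A : Matrix (Fin (d + 1)) (Fin (d + 1)) ℝ => A⁻¹) (q • M) := by
      simp only [Matrix.inv_def, Ring.inverse_eq_inv']
      exact ((Continuous.matrix_det continuous_id).continuousAt.inv₀ hne).smul
        (Continuous.matrix_adjugate continuous_id).continuousAt
    exact hc.tendsto.comp h
  rw [inv_smul_of_ne_zero hM hq.ne'] at hinv
  refine hinv.congr' ?_
  filter_upwards [h.eventually_isUnit_det hM hq, eventually_ne_atTop 0] with n hn hn0
  rw [inv_smul_of_ne_zero hn (inv_ne_zero (Nat.cast_ne_zero.2 hn0)), inv_inv]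

/-- The coefficient of the scores of the subsample `S'` in a plug-in G-formula over `S`. -/
theorem GramLimit.tendsto_vecMul {S' : ℕ → Finset ℕ} {q' : ℝ} (h : GramLimit z S q M)
    (h' : GramLimit z S' q' M) (hM0 : M 0 0 = 1) (hM : IsUnit M.det) (hq : 0 < q) (hq' : 0 < q') :
    Tendsto (fun n : ℕ => Matrix.vecMul (augMean z (S n)) ((n : ℝ) • (gram z (S' n))⁻¹)) atTop
      (𝓝 (q'⁻¹ • Pi.single 0 1)) := by
  -- Row `0` of `M` is `e₀ᵀ M`, so multiplying by `M⁻¹` gives `e₀` without any centering of the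
  -- covariates.
  have h1 : Matrix.vecMul (M 0) (q'⁻¹ • M⁻¹) = q'⁻¹ • Pi.single 0 1 := by
    rw [Matrix.vecMul_smul]
    congr 1
    have h2 : M 0 = Matrix.vecMul (Pi.single 0 1) M := by simp [Matrix.row]
    rw [h2, Matrix.vecMul_vecMul, Matrix.mul_nonsing_inv _ hM, Matrix.vecMul_one]
  rw [← h1]
  have hc : Continuous fun p : (Fin (d + 1) → ℝ) × Matrix (Fin (d + 1)) (Fin (d + 1)) ℝ =>
      Matrix.vecMul p.1 p.2 := Continuous.matrix_vecMul continuous_fst continuous_snd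
  have h2 := (h.tendsto_augMean hM0 hq).prodMk_nhds (h'.tendsto_inv hM hq')
  have h3 := (hc.tendsto (M 0, q'⁻¹ • M⁻¹)).comp h2
  simpa only [Function.comp_def] using h3

theorem GramLimit.sum {ι : Type*} [Fintype ι] {S : ι → ℕ → Finset ℕ} {q : ι → ℝ}
    {T : ℕ → Finset ℕ} (h : ∀ j, GramLimit z (S j) (q j) M)
    (hT : ∀ n, gram z (T n) = ∑ j, gram z (S j n)) : GramLimit z T (∑ j, q j) M := by
  have := tendsto_finsetSum Finset.univ fun j _ => h j
  simpa only [GramLimit, hT, Finset.smul_sum, Finset.sum_smul] using this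

end GramLimit

/-! ### The summands of the central limit theorem, cell by cell. -/

section CellFun

variable {d K : ℕ}

/-- The centered effect and the score components of an observation, restricted to one cell. -/
def cellFun (θ : Fin 2 → Fin (d + 1) → ℝ) (δ : Fin d → ℝ) (m : ℝ)
    (j : (Fin K × Fin 2) × Option (Fin (d + 1))) (z : Obs d K) : ℝ :=
  if z.study = j.1.1 ∧ z.trt = j.1.2 then
    j.2.elim (z.1 ⬝ᵥ δ - m) (fun a => (z.out - z.aug ⬝ᵥ θ j.1.2) * z.aug a) else 0

theorem measurable_ite_cell {g : Obs d K → ℝ} (hg : Measurable g) (k : Fin K) (w : Fin 2) :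
    Measurable fun z : Obs d K => if z.study = k ∧ z.trt = w then g z else 0 :=
  Measurable.ite ((measurable_study (measurableSet_singleton k)).inter
    (measurable_trt (measurableSet_singleton w))) hg measurable_const

theorem measurable_dot_fst (u : Fin d → ℝ) : Measurable fun z : Obs d K => z.1 ⬝ᵥ u :=
  measurable_dot (fun a => (measurable_pi_apply a).comp measurable_fst) fun _ => measurable_const

theorem measurable_dot_const (u : Fin d → ℝ) : Measurable fun x : Fin d → ℝ => x ⬝ᵥ u :=
  measurable_dot measurable_pi_apply fun _ => measurable_const

theorem measurable_vecCons (a : Fin (d + 1)) :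
    Measurable fun x : Fin d → ℝ => (Matrix.vecCons 1 x : Fin (d + 1) → ℝ) a := by
  refine Fin.cases ?_ (fun a => ?_) a
  · exact measurable_const
  · exact measurable_pi_apply a

theorem measurable_sub_vecCons_dot (θ : Fin (d + 1) → ℝ) :
    Measurable fun q : (Fin d → ℝ) × ℝ =>
      q.2 - (Matrix.vecCons 1 q.1 : Fin (d + 1) → ℝ) ⬝ᵥ θ :=
  measurable_snd.sub (measurable_dot
    (fun a => (measurable_vecCons a).comp measurable_fst) fun _ => measurable_const)

theorem measurable_residual (θ : Fin (d + 1) → ℝ) :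
    Measurable fun z : Obs d K => z.out - z.aug ⬝ᵥ θ :=
  measurable_out.sub (measurable_dot measurable_aug fun _ => measurable_const)

theorem measurable_cellFun (θ : Fin 2 → Fin (d + 1) → ℝ) (δ : Fin d → ℝ) (m : ℝ)
    (j : (Fin K × Fin 2) × Option (Fin (d + 1))) : Measurable (cellFun θ δ m j) := by
  obtain ⟨⟨k, w⟩, _ | a⟩ := j
  · exact measurable_ite_cell ((measurable_dot_fst δ).sub_const m) k w
  · exact measurable_ite_cell ((measurable_residual (θ w)).mul (measurable_aug a)) k w

theorem sum_cellIdx_eq (n : ℕ) (z : ℕ → Obs d K) (k : Fin K) (w : Fin 2) (f : Obs d K → ℝ) :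
    ∑ i ∈ cellIdx n z k w, f (z i) =
      ∑ i ∈ Finset.range n, if (z i).study = k ∧ (z i).trt = w then f (z i) else 0 := by
  rw [cellIdx, Finset.sum_filter]

/-- An observation lies in exactly one cell, so the square has no cross terms between cells; the
factor `Pi.single 0 1` keeps only the intercept score, which is the residual itself. -/
theorem sq_sum_cellFun (θ : Fin 2 → Fin (d + 1) → ℝ) (δ : Fin d → ℝ) (m : ℝ)
    (α b : Fin K → Fin 2 → ℝ) (z : Obs d K) :
    (∑ j : (Fin K × Fin 2) × Option (Fin (d + 1)),
      j.2.elim (α j.1.1 j.1.2) (fun a => b j.1.1 j.1.2 * (Pi.single 0 1 : Fin (d + 1) → ℝ) a) *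
        cellFun θ δ m j z) ^ 2 =
      ∑ k, ∑ w, if z.study = k ∧ z.trt = w then
        (α k w * (z.1 ⬝ᵥ δ - m) + b k w * (z.out - z.aug ⬝ᵥ θ w)) ^ 2 else 0 := by
  have h1 : (∑ j : (Fin K × Fin 2) × Option (Fin (d + 1)),
      j.2.elim (α j.1.1 j.1.2) (fun a => b j.1.1 j.1.2 * (Pi.single 0 1 : Fin (d + 1) → ℝ) a) *
        cellFun θ δ m j z) = α z.study z.trt * (z.1 ⬝ᵥ δ - m) +
          b z.study z.trt * (z.out - z.aug ⬝ᵥ θ z.trt) := by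
    rw [Fintype.sum_prod_type, Finset.sum_eq_single (z.study, z.trt)]
    · rw [Fintype.sum_option, Finset.sum_eq_single 0]
      · simp only [cellFun, and_self, if_true, Option.elim_none, Option.elim_some,
          Pi.single_eq_same, aug_zero, mul_one]
      · intro a _ ha
        simp [Pi.single_eq_of_ne ha]
      · simp
    · rintro ⟨k, w⟩ _ hne
      refine Finset.sum_eq_zero fun o _ => ?_
      rw [cellFun, if_neg, mul_zero]
      rintro ⟨rfl, rfl⟩
      exact hne rfl
    · simp
  rw [h1, ← Fintype.sum_prod_type' (f := fun k w => if z.study = k ∧ z.trt = w then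
    (α k w * (z.1 ⬝ᵥ δ - m) + b k w * (z.out - z.aug ⬝ᵥ θ w)) ^ 2 else 0),
    Finset.sum_eq_single (z.study, z.trt)]
  · simp
  · rintro ⟨k, w⟩ _ hne
    rw [if_neg]
    rintro ⟨rfl, rfl⟩
    exact hne rfl
  · simp

end CellFun

/-! ### Law of large numbers and asymptotic normality for the cells. -/

section Model

variable {Ω : Type*} [MeasurableSpace Ω] {P : Measure Ω} [IsProbabilityMeasure P]
  {d K : ℕ} {X : ℕ → Ω → Fin d → ℝ} {W : ℕ → Ω → Fin 2} {H : ℕ → Ω → Fin K}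
  {Y : Fin 2 → ℕ → Ω → ℝ} {ρ prob : Fin K → ℝ} {c : Fin 2 → ℝ} {β : Fin 2 → Fin d → ℝ} {σ : ℝ}

namespace HomogeneousModel

theorem study_nonempty (hM : HomogeneousModel P X W H Y ρ prob c β σ) : 0 < K := by
  rcases Nat.eq_zero_or_pos K with rfl | h
  · simpa using hM.sum_study_prob
  · exact h

omit [IsProbabilityMeasure P] in
theorem cellProb_pos (hM : HomogeneousModel P X W H Y ρ prob c β σ) (k : Fin K) (w : Fin 2) :
    0 < ρ k * armProb prob k w :=
  mul_pos (hM.study_pos k) (hM.armProb_pos k w)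

omit [IsProbabilityMeasure P] in
theorem memLp_cell (hM : HomogeneousModel P X W H Y ρ prob c β σ) (k : Fin K) (w : Fin 2)
    {g : (Fin d → ℝ) → ℝ → ℝ} {q : ENNReal} (hg : MemLp (fun ω => g (X 0 ω) (Y w 0 ω)) q P) :
    MemLp (fun ω => if (obs X W H Y 0 ω).study = k ∧ (obs X W H Y 0 ω).trt = w then
        g (obs X W H Y 0 ω).1 (obs X W H Y 0 ω).out else 0) q P := by
  have hs : MeasurableSet {ω | H 0 ω = k ∧ W 0 ω = w} :=
    (hM.measurable_H 0 (measurableSet_singleton k)).inter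
      (hM.measurable_W 0 (measurableSet_singleton w))
  convert hg.indicator hs using 1
  ext ω
  by_cases hc : H 0 ω = k ∧ W 0 ω = w
  · have hc' : (obs X W H Y 0 ω).study = k ∧ (obs X W H Y 0 ω).trt = w := hc
    rw [if_pos hc', Set.indicator_of_mem (show ω ∈ {ω | H 0 ω = k ∧ W 0 ω = w} from hc)]
    change g (X 0 ω) (Y (W 0 ω) 0 ω) = _
    rw [hc.2]
  · have hc' : ¬((obs X W H Y 0 ω).study = k ∧ (obs X W H Y 0 ω).trt = w) := hc
    rw [if_neg hc', Set.indicator_of_notMem (show ω ∉ {ω | H 0 ω = k ∧ W 0 ω = w} from hc)]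

theorem memLp_aug (hM : HomogeneousModel P X W H Y ρ prob c β σ) (a : Fin (d + 1)) :
    MemLp (fun ω => (Matrix.vecCons 1 (X 0 ω) : Fin (d + 1) → ℝ) a) 2 P := by
  refine Fin.cases ?_ (fun a => ?_) a
  · exact memLp_const 1
  · exact hM.memLp_X_apply a

/-- The law of large numbers for the Gram matrices of the cells. -/
theorem gramLimit_cell (hM : HomogeneousModel P X W H Y ρ prob c β σ)
    {Z : Ω → ℕ → Obs d K} (hZ : Z = fun ω i => obs X W H Y i ω) :
    ∀ᵐ ω ∂P, ∀ k w, GramLimit (Z ω)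
      (fun n => cellIdx n (Z ω) k w) (ρ k * armProb prob k w)
      (augMoment P (X 0)) := by
  subst hZ
  have h : ∀ k w a b, ∀ᵐ ω ∂P, Tendsto (fun n : ℕ => (n : ℝ)⁻¹ *
      gram (fun i => obs X W H Y i ω) (cellIdx n (fun i => obs X W H Y i ω) k w) a b) atTop
      (𝓝 (ρ k * armProb prob k w * augMoment P (X 0) a b)) := by
    intro k w a b
    set g : (Fin d → ℝ) → ℝ → ℝ := fun x _ => (Matrix.vecCons 1 x : Fin (d + 1) → ℝ) a *
      (Matrix.vecCons 1 x : Fin (d + 1) → ℝ) b with hg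
    have hgm : Measurable fun q : (Fin d → ℝ) × ℝ => g q.1 q.2 :=
      ((measurable_vecCons a).comp measurable_fst).mul ((measurable_vecCons b).comp measurable_fst)
    have hφ : Measurable fun z : Obs d K =>
        if z.study = k ∧ z.trt = w then z.aug a * z.aug b else 0 :=
      measurable_ite_cell ((measurable_aug a).mul (measurable_aug b)) k w
    have hL : Integrable (fun ω => g (X 0 ω) (Y w 0 ω)) P :=
      (hM.memLp_aug a).integrable_mul (hM.memLp_aug b)
    have hint := memLp_one_iff_integrable.1 (hM.memLp_cell k w (memLp_one_iff_integrable.2 hL))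
    have hslln := strong_law_ae_real (μ := P) (fun i ω => (fun z : Obs d K =>
        if z.study = k ∧ z.trt = w then z.aug a * z.aug b else 0) (obs X W H Y i ω)) hint
      (fun i j hij => (hM.indep.indepFun hij).comp hφ hφ) (fun i => (hM.ident i).comp hφ)
    have hE := hM.integral_cell k w hgm
    filter_upwards [hslln] with ω hω
    simp only [gram_apply]
    simp only [sum_cellIdx_eq _ _ k w (fun z => z.aug a * z.aug b), ← div_eq_inv_mul]
    refine hω.trans (le_of_eq (congrArg 𝓝 ?_))
    exact hE
  simp only [ae_all_iff]
  intro k w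
  have h' := ae_all_iff.2 fun a => ae_all_iff.2 fun b => h k w a b
  filter_upwards [h'] with ω hω
  exact tendsto_pi_nhds.2 fun a => tendsto_pi_nhds.2 fun b => hω a b

theorem augMoment_zero_zero : augMoment P (X 0) 0 0 = 1 := by
  simp [augMoment]

theorem ae_eventually_localFullRank (hM : HomogeneousModel P X W H Y ρ prob c β σ)
    {Z : Ω → ℕ → Obs d K} (hZ : Z = fun ω i => obs X W H Y i ω) :
    ∀ᵐ ω ∂P, ∀ᶠ n in atTop, LocalFullRank n (Z ω) := by
  subst hZ
  filter_upwards [hM.gramLimit_cell rfl] with ω hω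
  simp only [LocalFullRank, eventually_all]
  exact fun k w => (hω k w).eventually_isUnit_det hM.isUnit_det_augMoment (hM.cellProb_pos k w)

theorem tendsto_measure_localFullRank (hM : HomogeneousModel P X W H Y ρ prob c β σ)
    {Z : Ω → ℕ → Obs d K} (hZ : Z = fun ω i => obs X W H Y i ω) :
    Tendsto (fun n : ℕ => P {ω | LocalFullRank n (Z ω)}) atTop (𝓝 1) := by
  subst hZ
  exact tendsto_measure_one_of_ae_eventually
    (fun n => measurableSet_localFullRank hM.measurable_sample n) (hM.ae_eventually_localFullRank rfl)

theorem tendsto_measure_not_localFullRank (hM : HomogeneousModel P X W H Y ρ prob c β σ)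
    {Z : Ω → ℕ → Obs d K} (hZ : Z = fun ω i => obs X W H Y i ω) :
    Tendsto (fun n : ℕ => P {ω | ¬LocalFullRank n (Z ω)}) atTop (𝓝 0) := by
  subst hZ
  have h : ∀ n : ℕ, P {ω | ¬LocalFullRank n (fun i => obs X W H Y i ω)} =
      1 - P {ω | LocalFullRank n (fun i => obs X W H Y i ω)} := fun n =>
    prob_compl_eq_one_sub (measurableSet_localFullRank hM.measurable_sample n)
  simp only [h]
  simpa using ENNReal.Tendsto.sub tendsto_const_nhds (hM.tendsto_measure_localFullRank rfl)
    (Or.inl ENNReal.one_ne_top)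

omit [MeasurableSpace Ω] in
theorem out_sub_eq_resid (w : Fin 2) (ω : Ω) :
    Y w 0 ω - (Matrix.vecCons 1 (X 0 ω) : Fin (d + 1) → ℝ) ⬝ᵥ coef c β w =
      resid X Y c β w 0 ω := by
  simp [coef, resid]

theorem memLp_cellFun (hM : HomogeneousModel P X W H Y ρ prob c β σ) (m : ℝ)
    (j : (Fin K × Fin 2) × Option (Fin (d + 1))) :
    MemLp (fun ω => cellFun (coef c β) (β 1 - β 0) m j (obs X W H Y 0 ω)) 2 P := by
  obtain ⟨⟨k, w⟩, _ | a⟩ := j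
  · exact hM.memLp_cell k w (g := fun x _ => x ⬝ᵥ (β 1 - β 0) - m)
      ((hM.memLp_dot _).sub (memLp_const m))
  · refine hM.memLp_cell k w (g := fun x y => (y - (Matrix.vecCons 1 x : Fin (d + 1) → ℝ) ⬝ᵥ
      coef c β w) * (Matrix.vecCons 1 x : Fin (d + 1) → ℝ) a) ?_
    simp only [out_sub_eq_resid]
    exact hM.memLp_resid_mul w (measurable_vecCons a) (hM.memLp_aug a)

theorem integral_cellFun (hM : HomogeneousModel P X W H Y ρ prob c β σ)
    (j : (Fin K × Fin 2) × Option (Fin (d + 1))) :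
    ∫ ω, cellFun (coef c β) (β 1 - β 0) ((fun a => ∫ ω, X 0 ω a ∂P) ⬝ᵥ (β 1 - β 0)) j
      (obs X W H Y 0 ω) ∂P = 0 := by
  obtain ⟨⟨k, w⟩, _ | a⟩ := j
  · refine (hM.integral_cell k w (g := fun x _ => x ⬝ᵥ (β 1 - β 0) -
      (fun a => ∫ ω, X 0 ω a ∂P) ⬝ᵥ (β 1 - β 0)) ?_).trans ?_
    · exact ((measurable_dot_const _).comp measurable_fst).sub_const _
    · rw [integral_sub ((hM.memLp_dot _).integrable (by norm_num)) (integrable_const _),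
        hM.integral_dot]
      simp
  · refine (hM.integral_cell k w (g := fun x y => (y - (Matrix.vecCons 1 x : Fin (d + 1) → ℝ) ⬝ᵥ
      coef c β w) * (Matrix.vecCons 1 x : Fin (d + 1) → ℝ) a) ?_).trans ?_
    · exact (measurable_sub_vecCons_dot (coef c β w)).mul
        ((measurable_vecCons a).comp measurable_fst)
    · simp only [out_sub_eq_resid]
      rw [hM.integral_resid_mul w (measurable_vecCons a) (hM.memLp_aug a), mul_zero]

/-- All asymptotic variances are read off from this formula. Within a cell the cross term vanishes,
the residual being orthogonal to the centered effect. -/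
theorem integral_sq_sum_cellFun (hM : HomogeneousModel P X W H Y ρ prob c β σ)
    (α b : Fin K → Fin 2 → ℝ) :
    ∫ ω, (∑ j : (Fin K × Fin 2) × Option (Fin (d + 1)),
      j.2.elim (α j.1.1 j.1.2) (fun a => b j.1.1 j.1.2 * (Pi.single 0 1 : Fin (d + 1) → ℝ) a) *
        cellFun (coef c β) (β 1 - β 0) ((fun a => ∫ ω, X 0 ω a ∂P) ⬝ᵥ (β 1 - β 0)) j
          (obs X W H Y 0 ω)) ^ 2 ∂P =
    ∑ k, ∑ w, ρ k * armProb prob k w *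
      (α k w ^ 2 * ((β 1 - β 0) ⬝ᵥ (covMatrix P (X 0)).mulVec (β 1 - β 0)) +
        b k w ^ 2 * σ ^ 2) := by
  set δ := β 1 - β 0 with hδ
  set m := (fun a => ∫ ω, X 0 ω a ∂P) ⬝ᵥ δ with hm
  set G : Fin K → Fin 2 → (Fin d → ℝ) → ℝ → ℝ := fun k w x y =>
    α k w * (x ⬝ᵥ δ - m) +
      b k w * (y - (Matrix.vecCons 1 x : Fin (d + 1) → ℝ) ⬝ᵥ coef c β w) with hG
  have hGm : ∀ k w, Measurable fun q : (Fin d → ℝ) × ℝ => G k w q.1 q.2 := fun k w =>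
    ((((measurable_dot_const δ).comp measurable_fst).sub_const m).const_mul _).add
      ((measurable_sub_vecCons_dot (coef c β w)).const_mul _)
  have hD : MemLp (fun ω => X 0 ω ⬝ᵥ δ - m) 2 P := (hM.memLp_dot _).sub (memLp_const m)
  have hGL : ∀ k w, MemLp (fun ω => G k w (X 0 ω) (Y w 0 ω)) 2 P := by
    intro k w
    simp only [hG, out_sub_eq_resid]
    exact (hD.const_mul _).add ((hM.memLp_resid w).const_mul _)
  have hint : ∀ k w, Integrable (fun ω => if (obs X W H Y 0 ω).study = k ∧
      (obs X W H Y 0 ω).trt = w then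
        G k w (obs X W H Y 0 ω).1 (obs X W H Y 0 ω).out ^ 2 else 0) P := fun k w =>
    memLp_one_iff_integrable.1 (hM.memLp_cell k w (g := fun x y => G k w x y ^ 2)
      (memLp_one_iff_integrable.2 (hGL k w).integrable_sq))
  simp only [sq_sum_cellFun]
  change ∫ ω, ∑ k, ∑ w, (if (obs X W H Y 0 ω).study = k ∧ (obs X W H Y 0 ω).trt = w then
    G k w (obs X W H Y 0 ω).1 (obs X W H Y 0 ω).out ^ 2 else 0) ∂P = _
  rw [integral_finsetSum _ fun k _ => integrable_finsetSum _ fun w _ => hint k w]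
  refine Finset.sum_congr rfl fun k _ => ?_
  rw [integral_finsetSum _ fun w _ => hint k w]
  refine Finset.sum_congr rfl fun w _ => ?_
  rw [hM.integral_cell k w (g := fun x y => G k w x y ^ 2) ((hGm k w).pow_const 2)]
  congr 1
  simp only [hG, out_sub_eq_resid]
  have hexp : ∀ ω, (α k w * (X 0 ω ⬝ᵥ δ - m) + b k w * resid X Y c β w 0 ω) ^ 2 =
      α k w ^ 2 * (X 0 ω ⬝ᵥ δ - m) ^ 2 +
        (2 * α k w * b k w * (resid X Y c β w 0 ω * (X 0 ω ⬝ᵥ δ - m)) +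
          b k w ^ 2 * resid X Y c β w 0 ω ^ 2) := fun ω => by ring
  have hi1 : Integrable (fun ω => α k w ^ 2 * (X 0 ω ⬝ᵥ δ - m) ^ 2) P :=
    hD.integrable_sq.const_mul _
  have hi2 : Integrable (fun ω => 2 * α k w * b k w *
      (resid X Y c β w 0 ω * (X 0 ω ⬝ᵥ δ - m))) P :=
    ((hM.memLp_resid w).integrable_mul hD).const_mul _
  have hi3 : Integrable (fun ω => b k w ^ 2 * resid X Y c β w 0 ω ^ 2) P :=
    (hM.memLp_resid w).integrable_sq.const_mul _
  have h0 : ∫ ω, resid X Y c β w 0 ω * (X 0 ω ⬝ᵥ δ - m) ∂P = 0 :=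
    hM.integral_resid_mul w (f := fun x => x ⬝ᵥ δ - m)
      ((measurable_dot_const δ).sub_const _) hD
  have hi4 : Integrable (fun ω => 2 * α k w * b k w *
      (resid X Y c β w 0 ω * (X 0 ω ⬝ᵥ δ - m)) + b k w ^ 2 * resid X Y c β w 0 ω ^ 2) P :=
    hi2.add hi3
  simp only [hexp]
  rw [integral_add hi1 hi4, integral_add hi2 hi3, integral_const_mul,
    integral_const_mul, integral_const_mul, h0, hM.integral_resid_sq, hM.integral_sq_centered_dot]
  ring

/-- Asymptotic normality of linear combinations of the centered effects and the scores of the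
cells. -/
theorem asympNormal_of_cells (hM : HomogeneousModel P X W H Y ρ prob c β σ)
    {Z : Ω → ℕ → Obs d K} (hZ : Z = fun ω i => obs X W H Y i ω)
    {A : ℕ → Ω → Fin K → Fin 2 → ℝ} {B : ℕ → Ω → Fin K → Fin 2 → Fin (d + 1) → ℝ}
    {α b : Fin K → Fin 2 → ℝ}
    (hA : ∀ k w, TendstoInMeasure P (fun n ω => A n ω k w) atTop (fun _ => α k w))
    (hB : ∀ k w a, TendstoInMeasure P (fun n ω => B n ω k w a) atTop
      (fun _ => b k w * (Pi.single 0 1 : Fin (d + 1) → ℝ) a))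
    {T : ℕ → Ω → ℝ} (hTm : ∀ n, Measurable (T n)) {bad : ℕ → Set Ω}
    (hbad : Tendsto (fun n => P (bad n)) atTop (𝓝 0))
    (hT : ∀ n, ∀ ω ∉ bad n, LocalFullRank n (Z ω) → T n ω =
      ∑ k, ∑ w, (A n ω k w * ((√(n : ℝ))⁻¹ *
        ∑ i ∈ cellIdx n (Z ω) k w, ((Z ω i).1 ⬝ᵥ (β 1 - β 0) -
          (fun a => ∫ ω, X 0 ω a ∂P) ⬝ᵥ (β 1 - β 0))) +
        B n ω k w ⬝ᵥ ((√(n : ℝ))⁻¹ • score (Z ω)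
          (cellIdx n (Z ω) k w) (coef c β w))))
    {v : ℝ} (hv : ∑ k, ∑ w, ρ k * armProb prob k w *
      (α k w ^ 2 * ((β 1 - β 0) ⬝ᵥ (covMatrix P (X 0)).mulVec (β 1 - β 0)) +
        b k w ^ 2 * σ ^ 2) = v) :
    AsympNormal P T v := by
  subst hZ
  set m := (fun a => ∫ ω, X 0 ω a ∂P) ⬝ᵥ (β 1 - β 0) with hm
  refine asympNormal_of_linear (ξ := obs X W H Y) hM.indep hM.ident
    (ψ := cellFun (coef c β) (β 1 - β 0) m) (measurable_cellFun _ _ _) (hM.memLp_cellFun m)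
    hM.integral_cellFun
    -- The index `none` of a cell carries its centered effect, `some a` the coordinate `a` of its
    -- score.
    (C := fun n ω j => j.2.elim (A n ω j.1.1 j.1.2) (B n ω j.1.1 j.1.2))
    (a := fun j => j.2.elim (α j.1.1 j.1.2)
      (fun a => b j.1.1 j.1.2 * (Pi.single 0 1 : Fin (d + 1) → ℝ) a)) ?_
    (fun n => (hTm n).aemeasurable) ?_ ((hM.integral_sq_sum_cellFun α b).trans hv)
  · rintro ⟨⟨k, w⟩, _ | a⟩
    · exact hA k w
    · exact hB k w a
  · have hlim := hbad.add (hM.tendsto_measure_not_localFullRank rfl)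
    rw [add_zero] at hlim
    refine tendsto_of_tendsto_of_tendsto_of_le_of_le tendsto_const_nhds hlim
      (fun _ => zero_le) fun n => ?_
    refine (measure_mono fun ω hω => ?_).trans (measure_union_le _ _)
    by_contra hcon
    simp only [Set.mem_union, Set.mem_ofPred_eq, not_or, not_not] at hcon
    refine hω ((hT n ω hcon.1 hcon.2).trans ?_)
    rw [Fintype.sum_prod_type, Fintype.sum_prod_type]
    refine Finset.sum_congr rfl fun k _ => Finset.sum_congr rfl fun w _ => ?_
    rw [Fintype.sum_option]
    congr 1
    · simp only [Option.elim_none, cellFun]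
      rw [sum_cellIdx_eq n (fun i => obs X W H Y i ω) k w (fun z => z.1 ⬝ᵥ (β 1 - β 0) - m)]
    · rw [dotProduct]
      refine Finset.sum_congr rfl fun a _ => ?_
      simp only [Option.elim_some, cellFun, Pi.smul_apply, smul_eq_mul, score, Finset.sum_apply]
      rw [sum_cellIdx_eq n (fun i => obs X W H Y i ω) k w
        (fun z => (z.out - z.aug ⬝ᵥ coef c β w) * z.aug a)]

end HomogeneousModel

end Model

/-! ### Expansion of the normalized errors in effects and scores. -/

section Expansion

variable {d K : ℕ}

/-- The sign of the arm `w` in a treatment contrast. -/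
def armSign (w : Fin 2) : ℝ := if w = 1 then 1 else -1

theorem armSign_sq (w : Fin 2) : armSign w ^ 2 = 1 := by
  unfold armSign
  split_ifs <;> norm_num

/-- The factor `√n` is split as `n · (√n)⁻¹`: `n` stabilizes the inverse Gram matrix and `(√n)⁻¹`
normalizes the score. -/
theorem sqrt_mul_dot_mulVec {m : Type*} [Fintype m] {n : ℕ} (hn : n ≠ 0) (x s : m → ℝ)
    (R : Matrix m m ℝ) :
    √(n : ℝ) * (x ⬝ᵥ R.mulVec s) =
      Matrix.vecMul x ((n : ℝ) • R) ⬝ᵥ ((√(n : ℝ))⁻¹ • s) := by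
  have h : (0 : ℝ) < n := Nat.cast_pos.2 (Nat.pos_of_ne_zero hn)
  have h2 : √(n : ℝ) * √(n : ℝ) = n := Real.mul_self_sqrt h.le
  have h3 : √(n : ℝ) ≠ 0 := (Real.sqrt_pos.2 h).ne'
  rw [Matrix.vecMul_smul, smul_dotProduct, dotProduct_smul, Matrix.dotProduct_mulVec, smul_eq_mul,
    smul_eq_mul, ← mul_assoc]
  congr 1
  rw [eq_mul_inv_iff_mul_eq₀ h3, h2]

variable {n : ℕ} {z : ℕ → Obs d K}

/-- The normalized error of a local estimator. -/
theorem sqrt_mul_tauLocal_sub (hK : 0 < K) (h : LocalFullRank n z) (k : Fin K)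
    (c : Fin 2 → ℝ) (β : Fin 2 → Fin d → ℝ) (m : ℝ) :
    √(n : ℝ) * (tauLocal n z k - (c 1 - c 0 + m)) =
      ∑ w, (((n : ℝ) / (studyIdx n z k).card) * ((√(n : ℝ))⁻¹ *
          ∑ i ∈ cellIdx n z k w, ((z i).1 ⬝ᵥ (β 1 - β 0) - m)) +
        (armSign w • Matrix.vecMul (augMean z (studyIdx n z k))
          ((n : ℝ) • (gram z (cellIdx n z k w))⁻¹)) ⬝ᵥ
            ((√(n : ℝ))⁻¹ • score z (cellIdx n z k w) (coef c β w))) := by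
  have hn := h.ne_zero hK
  have hn' : (0 : ℝ) < n := Nat.cast_pos.2 (Nat.pos_of_ne_zero hn)
  have h3 : √(n : ℝ) ≠ 0 := (Real.sqrt_pos.2 hn').ne'
  have h2 : √(n : ℝ) * √(n : ℝ) = n := Real.mul_self_sqrt hn'.le
  rw [tauLocal, gFormula_sub z (h.card_studyIdx_ne_zero k) _ c β m, mul_add,
    Finset.sum_add_distrib, sum_studyIdx, Finset.mul_sum, Finset.mul_sum, Finset.mul_sum]
  congr 1
  · refine Finset.sum_congr rfl fun w _ => ?_
    have h4 : √(n : ℝ) = n * (√(n : ℝ))⁻¹ := by rw [eq_mul_inv_iff_mul_eq₀ h3, h2]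
    linear_combination (((studyIdx n z k).card : ℝ)⁻¹ *
      ∑ i ∈ cellIdx n z k w, ((z i).1 ⬝ᵥ (β 1 - β 0) - m)) * h4
  · refine Finset.sum_congr rfl fun w _ => ?_
    rw [thetaLocal, ols_sub z (h k w), smul_dotProduct, ← sqrt_mul_dot_mulVec hn, armSign,
      smul_eq_mul]
    ring

/-- The normalized error of a plug-in G-formula over the whole sample, when the error of the
parameters is linear in the scores of the cells. -/
theorem sqrt_mul_gFormula_range_sub (hn : n ≠ 0) (c : Fin 2 → ℝ) (β : Fin 2 → Fin d → ℝ) (m : ℝ)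
    {θ : Fin 2 → Fin (d + 1) → ℝ} {R : Fin K → Fin 2 → Matrix (Fin (d + 1)) (Fin (d + 1)) ℝ}
    (hθ : ∀ w, θ w - coef c β w =
      ∑ k, (R k w).mulVec (score z (cellIdx n z k w) (coef c β w))) :
    √(n : ℝ) * (gFormula z (Finset.range n) θ - (c 1 - c 0 + m)) =
      ∑ k, ∑ w, (1 * ((√(n : ℝ))⁻¹ *
          ∑ i ∈ cellIdx n z k w, ((z i).1 ⬝ᵥ (β 1 - β 0) - m)) +
        (armSign w • Matrix.vecMul (augMean z (Finset.range n)) ((n : ℝ) • R k w)) ⬝ᵥ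
            ((√(n : ℝ))⁻¹ • score z (cellIdx n z k w) (coef c β w))) := by
  have hn' : (0 : ℝ) < n := Nat.cast_pos.2 (Nat.pos_of_ne_zero hn)
  have h3 : √(n : ℝ) ≠ 0 := (Real.sqrt_pos.2 hn').ne'
  have h2 : √(n : ℝ) * √(n : ℝ) = n := Real.mul_self_sqrt hn'.le
  rw [gFormula_sub z (by simpa using hn) _ c β m, mul_add]
  simp only [Finset.sum_add_distrib]
  congr 1
  · simp only [one_mul, ← Finset.mul_sum, ← sum_studyIdx, ← sum_range_eq, Finset.card_range]
    rw [← mul_assoc]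
    congr 1
    nth_rewrite 2 [← h2]
    field_simp
  · rw [Finset.sum_comm, Finset.mul_sum]
    refine Finset.sum_congr rfl fun w _ => ?_
    rw [hθ, dotProduct_sum, Finset.mul_sum, Finset.mul_sum]
    refine Finset.sum_congr rfl fun k _ => ?_
    rw [smul_dotProduct, ← sqrt_mul_dot_mulVec hn, armSign, smul_eq_mul]
    ring

theorem score_armIdx (w : Fin 2) (θ : Fin (d + 1) → ℝ) :
    score z (armIdx n z w) θ = ∑ k, score z (cellIdx n z k w) θ :=
  sum_armIdx n z w _

theorem thetaPool_sub (h : FederatedFullRank n z) (c : Fin 2 → ℝ) (β : Fin 2 → Fin d → ℝ)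
    (w : Fin 2) : thetaPool n z w - coef c β w =
      ∑ k, (gram z (armIdx n z w))⁻¹.mulVec (score z (cellIdx n z k w) (coef c β w)) := by
  rw [thetaPool, ols_sub z (h w), score_armIdx, Matrix.mulVec_sum]

/-- The weights sum to one, so the true parameter can be subtracted inside the average. -/
theorem theta1SSW_sub (hK : 0 < K) (h : LocalFullRank n z) (c : Fin 2 → ℝ)
    (β : Fin 2 → Fin d → ℝ) (w : Fin 2) : theta1SSW n z w - coef c β w =
      ∑ k, ((((cellIdx n z k w).card : ℝ) / ((armIdx n z w).card : ℝ)) •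
        (gram z (cellIdx n z k w))⁻¹).mulVec (score z (cellIdx n z k w) (coef c β w)) := by
  have hw : ((armIdx n z w).card : ℝ) ≠ 0 :=
    Nat.cast_ne_zero.2 (card_ne_zero_of_isUnit_det (h.federated hK w))
  have h1 : ∑ k, ((cellIdx n z k w).card : ℝ) / ((armIdx n z w).card : ℝ) = 1 := by
    rw [← Finset.sum_div, sum_card_cellIdx, div_self hw]
  have h2 : coef c β w = ∑ k, (((cellIdx n z k w).card : ℝ) / ((armIdx n z w).card : ℝ)) •
      coef c β w := by
    rw [← Finset.sum_smul, h1, one_smul]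
  rw [theta1SSW]
  nth_rewrite 1 [h2]
  rw [← Finset.sum_sub_distrib]
  refine Finset.sum_congr rfl fun k _ => ?_
  rw [← smul_sub, thetaLocal, ols_sub z (h k w), Matrix.smul_mulVec]

theorem moment_armIdx (w : Fin 2) :
    moment z (armIdx n z w) = ∑ k, moment z (cellIdx n z k w) :=
  sum_armIdx n z w _

/-- Each precision matrix cancels the inverse in the local OLS and leaves the moment vector, up to
`σ⁻²`. Gram matrices and moments add over studies and the factors `σ⁻²` cancel, so the equality is
exact. -/
theorem theta1SIVW_eq (hK : 0 < K) (h : LocalFullRank n z) {σ : ℝ} (hσ : σ ≠ 0) (w : Fin 2) :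
    theta1SIVW σ n z w = thetaPool n z w := by
  have hs : (1 / σ ^ 2 : ℝ) ≠ 0 := by positivity
  have h1 : ∀ k, (precision σ n z k w).mulVec (thetaLocal n z k w) =
      (1 / σ ^ 2 : ℝ) • moment z (cellIdx n z k w) := by
    intro k
    rw [precision, Matrix.smul_mulVec, thetaLocal, ols, Matrix.mulVec_mulVec,
      Matrix.mul_nonsing_inv _ (h k w), Matrix.one_mulVec]
  rw [theta1SIVW, Finset.sum_congr rfl fun k _ => h1 k, ← Finset.smul_sum, ← moment_armIdx]
  simp only [precision]
  rw [← Finset.smul_sum, ← gram_armIdx, inv_smul_of_ne_zero (h.federated hK w) hs,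
    Matrix.smul_mulVec, Matrix.mulVec_smul, smul_smul, inv_mul_cancel₀ hs, one_smul, thetaPool, ols]

end Expansion

/-! ### Asymptotic normality of weighted local estimators and of whole-sample G-formulas. -/

section Model

variable {Ω : Type*} [MeasurableSpace Ω] {P : Measure Ω} [IsProbabilityMeasure P]
  {d K : ℕ} {X : ℕ → Ω → Fin d → ℝ} {W : ℕ → Ω → Fin 2} {H : ℕ → Ω → Fin K}
  {Y : Fin 2 → ℕ → Ω → ℝ} {ρ prob : Fin K → ℝ} {c : Fin 2 → ℝ} {β : Fin 2 → Fin d → ℝ} {σ : ℝ}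
  {Z : Ω → ℕ → Obs d K}

namespace HomogeneousModel

omit [IsProbabilityMeasure P] in
theorem measurable_sample_of_eq (hM : HomogeneousModel P X W H Y ρ prob c β σ)
    (hZ : Z = fun ω i => obs X W H Y i ω) : Measurable Z := by
  subst hZ
  exact hM.measurable_sample

theorem sum_armProb (k : Fin K) : ∑ w, armProb prob k w = 1 := by
  simp [armProb, Fin.sum_univ_two]

/-- The probability of receiving treatment `w`. -/
theorem sum_cellProb (hM : HomogeneousModel P X W H Y ρ prob c β σ) (w : Fin 2) :
    ∑ k, ρ k * armProb prob k w =
      if w = 1 then ∑ k, ρ k * prob k else 1 - ∑ k, ρ k * prob k := by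
  unfold armProb
  split_ifs
  · rfl
  · simp only [mul_sub, mul_one, Finset.sum_sub_distrib, hM.sum_study_prob]

theorem armProb_total_pos (hM : HomogeneousModel P X W H Y ρ prob c β σ) (w : Fin 2) :
    0 < ∑ k, ρ k * armProb prob k w := by
  have : Nonempty (Fin K) := ⟨⟨0, hM.study_nonempty⟩⟩
  exact Finset.sum_pos (fun k _ => hM.cellProb_pos k w) Finset.univ_nonempty

theorem gramLimit_study (hM : HomogeneousModel P X W H Y ρ prob c β σ)
    (hZ : Z = fun ω i => obs X W H Y i ω) :
    ∀ᵐ ω ∂P, ∀ k, GramLimit (Z ω) (fun n => studyIdx n (Z ω) k) (ρ k)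
      (augMoment P (X 0)) := by
  filter_upwards [hM.gramLimit_cell hZ] with ω hω k
  have := GramLimit.sum (hω k) (fun n => gram_studyIdx n (Z ω) k)
  rwa [← Finset.mul_sum, sum_armProb, mul_one] at this

theorem gramLimit_arm (hM : HomogeneousModel P X W H Y ρ prob c β σ)
    (hZ : Z = fun ω i => obs X W H Y i ω) :
    ∀ᵐ ω ∂P, ∀ w, GramLimit (Z ω) (fun n => armIdx n (Z ω) w) (∑ k, ρ k * armProb prob k w)
      (augMoment P (X 0)) := by
  filter_upwards [hM.gramLimit_cell hZ] with ω hω w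
  exact GramLimit.sum (fun k => hω k w) (fun n => gram_armIdx n (Z ω) w)

theorem gramLimit_range (hM : HomogeneousModel P X W H Y ρ prob c β σ)
    (hZ : Z = fun ω i => obs X W H Y i ω) :
    ∀ᵐ ω ∂P, GramLimit (Z ω) (fun n => Finset.range n) 1 (augMoment P (X 0)) := by
  filter_upwards [hM.gramLimit_study hZ] with ω hω
  have := GramLimit.sum hω (fun n => sum_range_eq n (Z ω) _)
  rwa [hM.sum_study_prob] at this

theorem measurable_augMean {n : ℕ} {S : Ω → Finset ℕ} (hZm : Measurable Z)
    (hS : MeasurableIdx n S) (a : Fin (d + 1)) : Measurable fun ω => augMean (Z ω) (S ω) a :=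
  hS.card.inv.mul (measurable_gram hZm hS 0 a)

/-- Convergence of the coefficients of the scores in a plug-in G-formula. -/
theorem tendstoInMeasure_vecMul (hM : HomogeneousModel P X W H Y ρ prob c β σ)
    (hZm : Measurable Z) {S S' : ℕ → Ω → Finset ℕ} {q q' : ℝ}
    (hS : ∀ n, MeasurableIdx n (S n)) (hS' : ∀ n, MeasurableIdx n (S' n))
    (hG : ∀ᵐ ω ∂P, GramLimit (Z ω) (fun n => S n ω) q (augMoment P (X 0)))
    (hG' : ∀ᵐ ω ∂P, GramLimit (Z ω) (fun n => S' n ω) q' (augMoment P (X 0)))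
    (hq : 0 < q) (hq' : 0 < q') (a : Fin (d + 1)) :
    TendstoInMeasure P (fun (n : ℕ) ω => Matrix.vecMul (augMean (Z ω) (S n ω))
      ((n : ℝ) • (gram (Z ω) (S' n ω))⁻¹) a) atTop
      (fun _ => q'⁻¹ * (Pi.single 0 1 : Fin (d + 1) → ℝ) a) := by
  refine tendstoInMeasure_of_tendsto_ae (fun n => Measurable.aestronglyMeasurable ?_) ?_
  · simp only [Matrix.vecMul, dotProduct, Matrix.smul_apply, smul_eq_mul]
    exact Finset.measurable_sum _ fun b _ => (measurable_augMean hZm (hS n) b).mul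
      ((measurable_matrix_inv (measurable_gram hZm (hS' n)) b a).const_mul _)
  · filter_upwards [hG, hG'] with ω h h'
    exact tendsto_pi_nhds.1 (h.tendsto_vecMul h' augMoment_zero_zero hM.isUnit_det_augMoment
      hq hq') a

theorem ae_tendsto_card_study (hM : HomogeneousModel P X W H Y ρ prob c β σ)
    (hZ : Z = fun ω i => obs X W H Y i ω) (k : Fin K) :
    ∀ᵐ ω ∂P, Tendsto (fun n : ℕ => ((studyIdx n (Z ω) k).card : ℝ) / n) atTop (𝓝 (ρ k)) := by
  filter_upwards [hM.gramLimit_study hZ] with ω hω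
  exact (hω k).tendsto_card augMoment_zero_zero

theorem tendstoInMeasure_card_study (hM : HomogeneousModel P X W H Y ρ prob c β σ)
    (hZ : Z = fun ω i => obs X W H Y i ω) (k : Fin K) :
    TendstoInMeasure P (fun (n : ℕ) ω => ((studyIdx n (Z ω) k).card : ℝ) / n) atTop
      (fun _ => ρ k) :=
  tendstoInMeasure_of_tendsto_ae
    (fun n => ((measurableIdx_study (hM.measurable_sample_of_eq hZ) n k).card.div_const
      _).aestronglyMeasurable) (hM.ae_tendsto_card_study hZ k)

theorem tendstoInMeasure_div_card_study (hM : HomogeneousModel P X W H Y ρ prob c β σ)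
    (hZ : Z = fun ω i => obs X W H Y i ω) (k : Fin K) :
    TendstoInMeasure P (fun (n : ℕ) ω => (n : ℝ) / ((studyIdx n (Z ω) k).card : ℝ)) atTop
      (fun _ => (ρ k)⁻¹) := by
  refine tendstoInMeasure_of_tendsto_ae
    (fun n => ((measurableIdx_study (hM.measurable_sample_of_eq hZ) n k).card.const_div
      _).aestronglyMeasurable) ?_
  filter_upwards [hM.ae_tendsto_card_study hZ k] with ω hω
  simpa using hω.inv₀ (hM.study_pos k).ne'

/-- Asymptotic normality of weighted combinations of the local estimators. -/
theorem asympNormal_weighted_local (hM : HomogeneousModel P X W H Y ρ prob c β σ)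
    (hZ : Z = fun ω i => obs X W H Y i ω) {l : ℕ → Ω → Fin K → ℝ} {l₀ : Fin K → ℝ}
    (hl : ∀ k, TendstoInMeasure P (fun n ω => l n ω k) atTop (fun _ => l₀ k))
    {T : ℕ → Ω → ℝ} (hTm : ∀ n, Measurable (T n)) {bad : ℕ → Set Ω}
    (hbad : Tendsto (fun n => P (bad n)) atTop (𝓝 0))
    (hT : ∀ n, ∀ ω ∉ bad n, LocalFullRank n (Z ω) → T n ω =
      ∑ k, l n ω k * (√(n : ℝ) * (tauLocal n (Z ω) k - ate P Y)))
    {v : ℝ} (hv : ∑ k, l₀ k ^ 2 / ρ k * (σ ^ 2 / (prob k * (1 - prob k)) +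
      (β 1 - β 0) ⬝ᵥ (covMatrix P (X 0)).mulVec (β 1 - β 0)) = v) :
    AsympNormal P T v := by
  have hZm := hM.measurable_sample_of_eq hZ
  refine hM.asympNormal_of_cells hZ
    (A := fun n ω k _ => l n ω k * ((n : ℝ) / (studyIdx n (Z ω) k).card))
    (B := fun n ω k w => l n ω k • (armSign w • Matrix.vecMul (augMean (Z ω) (studyIdx n (Z ω) k))
          ((n : ℝ) • (gram (Z ω) (cellIdx n (Z ω) k w))⁻¹)))
    -- Limits of `l_k n / n_k` and of the signed intercept coefficient, the cell having proportion
    -- `ρ_k p_kw`.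
    (α := fun k _ => l₀ k * (ρ k)⁻¹)
    (b := fun k w => l₀ k * (armSign w * (ρ k * armProb prob k w)⁻¹))
    (fun k w => tendstoInMeasure_mul (hl k) (hM.tendstoInMeasure_div_card_study hZ k))
    (fun k w a => ?_) hTm hbad (fun n ω hω h => ?_) ?_
  · have h1 := hM.tendstoInMeasure_vecMul hZm (fun n => measurableIdx_study hZm n k)
      (fun n => measurableIdx_cell hZm n k w)
      ((hM.gramLimit_study hZ).mono fun ω h => h k)
      ((hM.gramLimit_cell hZ).mono fun ω h => h k w) (hM.study_pos k) (hM.cellProb_pos k w) a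
    have h2 : TendstoInMeasure P (fun _ _ => armSign w) (atTop : Filter ℕ)
        (fun _ => armSign w) :=
      tendstoInMeasure_of_tendsto_ae (fun _ => aestronglyMeasurable_const)
        (ae_of_all _ fun _ => tendsto_const_nhds)
    simpa only [Pi.smul_apply, smul_eq_mul, mul_assoc] using
      tendstoInMeasure_mul (hl k) (tendstoInMeasure_mul h2 h1)
  · rw [hT n ω hω h]
    refine Finset.sum_congr rfl fun k _ => ?_
    rw [hM.ate_eq, sqrt_mul_tauLocal_sub hM.study_nonempty h k c β, Finset.mul_sum]
    refine Finset.sum_congr rfl fun w _ => ?_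
    rw [mul_add, mul_assoc, smul_dotProduct (l n ω k), smul_eq_mul]
  -- In each study the arm probabilities sum to one and `1 / p_k + 1 / (1 - p_k) = 1 / (p_k (1 -
  -- p_k))`.
  · rw [← hv]
    refine Finset.sum_congr rfl fun k _ => ?_
    have h1 := hM.study_pos k
    have h2 := hM.treat_pos k
    have h3 : 0 < 1 - prob k := sub_pos.2 (hM.treat_lt_one k)
    simp only [Fin.sum_univ_two, mul_pow, armSign_sq]
    simp only [armProb, zero_ne_one, if_false, if_true]
    field_simp
    ring

/-- Asymptotic normality of plug-in G-formulas over the whole sample. -/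
theorem asympNormal_gFormula_range (hM : HomogeneousModel P X W H Y ρ prob c β σ)
    (hZ : Z = fun ω i => obs X W H Y i ω) {θ : ℕ → Ω → Fin 2 → Fin (d + 1) → ℝ}
    {R : ℕ → Ω → Fin K → Fin 2 → Matrix (Fin (d + 1)) (Fin (d + 1)) ℝ}
    (hR : ∀ k w a, TendstoInMeasure P (fun (n : ℕ) ω =>
      Matrix.vecMul (augMean (Z ω) (Finset.range n)) ((n : ℝ) • R n ω k w) a) atTop
      (fun _ => (∑ k, ρ k * armProb prob k w)⁻¹ * (Pi.single 0 1 : Fin (d + 1) → ℝ) a))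
    (hθ : ∀ n ω, LocalFullRank n (Z ω) → ∀ w, θ n ω w - coef c β w =
      ∑ k, (R n ω k w).mulVec (score (Z ω) (cellIdx n (Z ω) k w) (coef c β w)))
    {T : ℕ → Ω → ℝ} (hTm : ∀ n, Measurable (T n)) {bad : ℕ → Set Ω}
    (hbad : Tendsto (fun n => P (bad n)) atTop (𝓝 0))
    (hT : ∀ n, ∀ ω ∉ bad n, LocalFullRank n (Z ω) → T n ω =
      √(n : ℝ) * (gFormula (Z ω) (Finset.range n) (θ n ω) - ate P Y)) :
    AsympNormal P T (σ ^ 2 / ((∑ k, ρ k * prob k) * (1 - ∑ k, ρ k * prob k)) +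
      (β 1 - β 0) ⬝ᵥ (covMatrix P (X 0)).mulVec (β 1 - β 0)) := by
  refine hM.asympNormal_of_cells hZ (A := fun _ _ _ _ => 1)
    (B := fun n ω k w => armSign w • Matrix.vecMul (augMean (Z ω) (Finset.range n))
      ((n : ℝ) • R n ω k w))
    (α := fun _ _ => 1) (b := fun _ w => armSign w * (∑ k, ρ k * armProb prob k w)⁻¹)
    (fun k w => ?_) (fun k w a => ?_) hTm hbad (fun n ω hω h => ?_) ?_
  · exact tendstoInMeasure_of_tendsto_ae (fun _ => aestronglyMeasurable_const)
        (ae_of_all _ fun _ => tendsto_const_nhds)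
  · have h2 : TendstoInMeasure P (fun _ _ => armSign w) (atTop : Filter ℕ)
        (fun _ => armSign w) :=
      tendstoInMeasure_of_tendsto_ae (fun _ => aestronglyMeasurable_const)
        (ae_of_all _ fun _ => tendsto_const_nhds)
    simpa only [Pi.smul_apply, smul_eq_mul, mul_assoc] using tendstoInMeasure_mul h2 (hR k w a)
  · rw [hT n ω hω h, hM.ate_eq]
    exact sqrt_mul_gFormula_range_sub (h.ne_zero hM.study_nonempty) c β _ (hθ n ω h)
  -- Since `b` depends on the arm only, summing over studies leaves one inverse arm probability per
  -- arm, and `1 / p + 1 / (1 - p) = 1 / (p (1 - p))`.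
  · have hp := hM.armProb_total_pos
    simp only [one_pow, one_mul, mul_pow, armSign_sq, inv_pow, mul_add]
    rw [Finset.sum_comm]
    simp only [Finset.sum_add_distrib, ← Finset.sum_mul]
    have h1 : ∑ w, ∑ k, ρ k * armProb prob k w = 1 := by
      rw [Finset.sum_comm]
      simp only [← Finset.mul_sum, sum_armProb, mul_one, hM.sum_study_prob]
    rw [h1, Fin.sum_univ_two]
    have h0 := hp 0
    have h3 := hp 1
    simp only [hM.sum_cellProb, zero_ne_one, if_false, if_true] at h0 h3 ⊢
    field_simp
    ring

/-- Allowing `T` to agree with the pooled error only off events of vanishing probability makes this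
serve 1S-IVW and GD too. -/
theorem asympNormal_pool_of_eq (hM : HomogeneousModel P X W H Y ρ prob c β σ)
    (hZ : Z = fun ω i => obs X W H Y i ω) {T : ℕ → Ω → ℝ} (hTm : ∀ n, Measurable (T n))
    {bad : ℕ → Set Ω} (hbad : Tendsto (fun n => P (bad n)) atTop (𝓝 0))
    (hT : ∀ n, ∀ ω ∉ bad n, LocalFullRank n (Z ω) → T n ω =
      √(n : ℝ) * (tauPool n (Z ω) - ate P Y)) :
    AsympNormal P T (σ ^ 2 / ((∑ k, ρ k * prob k) * (1 - ∑ k, ρ k * prob k)) +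
      (β 1 - β 0) ⬝ᵥ (covMatrix P (X 0)).mulVec (β 1 - β 0)) := by
  have hZm := hM.measurable_sample_of_eq hZ
  exact hM.asympNormal_gFormula_range hZ (θ := fun n ω => thetaPool n (Z ω))
    (R := fun n ω _ w => (gram (Z ω) (armIdx n (Z ω) w))⁻¹)
    (fun k w a => hM.tendstoInMeasure_vecMul hZm (fun n => measurableIdx_range n)
      (fun n => measurableIdx_arm hZm n w) (hM.gramLimit_range hZ)
      ((hM.gramLimit_arm hZ).mono fun ω h => h w) one_pos (hM.armProb_total_pos w) a)
    (fun n ω h => thetaPool_sub (h.federated hM.study_nonempty) c β) hTm hbad hT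

/-- The weight `n_k^(w) / n^(w)` tends to the cell probability over the arm probability. The cell
probability cancels against the local inverse Gram matrix, leaving the pooled coefficient. -/
theorem asympNormal_tau1SSW (hM : HomogeneousModel P X W H Y ρ prob c β σ)
    (hZ : Z = fun ω i => obs X W H Y i ω) :
    AsympNormal P (fun n ω => √(n : ℝ) * (tau1SSW n (Z ω) - ate P Y))
      (σ ^ 2 / ((∑ k, ρ k * prob k) * (1 - ∑ k, ρ k * prob k)) +
      (β 1 - β 0) ⬝ᵥ (covMatrix P (X 0)).mulVec (β 1 - β 0)) := by
  have hZm := hM.measurable_sample_of_eq hZ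
  refine hM.asympNormal_gFormula_range hZ (θ := fun n ω => theta1SSW n (Z ω))
    (R := fun n ω k w => (((cellIdx n (Z ω) k w).card : ℝ) / ((armIdx n (Z ω) w).card : ℝ)) •
      (gram (Z ω) (cellIdx n (Z ω) k w))⁻¹) (fun k w a => ?_)
    (fun n ω h => theta1SSW_sub hM.study_nonempty h c β)
    (fun n => ((measurable_tau1SSW hZm n).sub_const _).const_mul _) (bad := fun _ => ∅)
    (by simp) (fun n ω _ _ => by rw [tau1SSW, aggregateSW_eq])
  have h1 := hM.tendstoInMeasure_vecMul hZm (fun n => measurableIdx_range n)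
      (fun n => measurableIdx_cell hZm n k w) (hM.gramLimit_range hZ)
      ((hM.gramLimit_cell hZ).mono fun ω h => h k w) one_pos (hM.cellProb_pos k w) a
  have h2 : TendstoInMeasure P (fun (n : ℕ) ω =>
      ((cellIdx n (Z ω) k w).card : ℝ) / ((armIdx n (Z ω) w).card : ℝ)) atTop
      (fun _ => (ρ k * armProb prob k w) / ∑ k, ρ k * armProb prob k w) := by
    refine tendstoInMeasure_of_tendsto_ae (fun n => ((measurableIdx_cell hZm n k w).card.div
      (measurableIdx_arm hZm n w).card).aestronglyMeasurable) ?_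
    filter_upwards [hM.gramLimit_cell hZ, hM.gramLimit_arm hZ] with ω h h'
    refine (((h k w).tendsto_card augMoment_zero_zero).div ((h' w).tendsto_card
      augMoment_zero_zero) (hM.armProb_total_pos w).ne').congr' ?_
    filter_upwards [eventually_ne_atTop 0] with n hn
    exact div_div_div_cancel_right₀ (Nat.cast_ne_zero.2 hn) _ _
  have h3 := tendstoInMeasure_mul h2 h1
  have h4 : (ρ k * armProb prob k w) / (∑ k, ρ k * armProb prob k w) *
      ((ρ k * armProb prob k w)⁻¹ * (Pi.single 0 1 : Fin (d + 1) → ℝ) a) =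
      (∑ k, ρ k * armProb prob k w)⁻¹ * (Pi.single 0 1 : Fin (d + 1) → ℝ) a := by
    have := (hM.cellProb_pos k w).ne'
    rw [← mul_assoc, div_mul_eq_mul_div, mul_inv_cancel₀ this, one_div]
  rw [h4] at h3
  refine h3.congr_left fun n => ae_of_all _ fun ω => ?_
  simp only [Matrix.vecMul_smul, Pi.smul_apply, smul_eq_mul]
  ring

end HomogeneousModel

end Model

/-! ### Convergence of FedAvg with one local step. -/

section GradientDescent

/-- Powers of `1 - η A` tend to zero when all the eigenvalues of `η A` lie in `(0, 2)`. -/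
theorem tendsto_one_sub_smul_pow_mulVec {m : Type*} [Fintype m] [DecidableEq m]
    {A : Matrix m m ℝ} (hA : A.PosDef) {η : ℝ} (hη : 0 < η)
    (hs : ∀ l ∈ spectrum ℝ A, η * l < 2) (e : m → ℝ) :
    Tendsto (fun T : ℕ => ((1 - η • A) ^ T).mulVec e) atTop (𝓝 0) := by
  set b := hA.1.eigenvectorBasis with hb
  set r := b.repr (WithLp.toLp 2 e) with hr
  have he : e = ∑ i, r i • (b i : m → ℝ) := by
    have h := congrArg WithLp.ofLp (b.sum_repr (WithLp.toLp 2 e))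
    simpa using h.symm
  have hstep : ∀ i (T : ℕ), ((1 - η • A) ^ T).mulVec (b i : m → ℝ) =
      (1 - η * hA.1.eigenvalues i) ^ T • (b i : m → ℝ) := by
    intro i T
    induction T with
    | zero => simp
    | succ T ih =>
      rw [pow_succ, ← Matrix.mulVec_mulVec, Matrix.sub_mulVec, Matrix.one_mulVec,
        Matrix.smul_mulVec, hb, hA.1.mulVec_eigenvectorBasis, smul_smul, ← hb,
        show (b i : m → ℝ) - (η * hA.1.eigenvalues i) • (b i : m → ℝ) =
          (1 - η * hA.1.eigenvalues i) • (b i : m → ℝ) by rw [sub_smul, one_smul],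
        Matrix.mulVec_smul, ih, smul_smul, pow_succ, mul_comm]
  have hform : ∀ T : ℕ, ((1 - η • A) ^ T).mulVec e =
      ∑ i, (r i * (1 - η * hA.1.eigenvalues i) ^ T) • (b i : m → ℝ) := by
    intro T
    rw [he, Matrix.mulVec_sum]
    refine Finset.sum_congr rfl fun i _ => ?_
    rw [Matrix.mulVec_smul, hstep, smul_smul]
  simp only [hform]
  have hlim : ∀ i, Tendsto (fun T : ℕ => (r i * (1 - η * hA.1.eigenvalues i) ^ T) •
      (b i : m → ℝ)) atTop (𝓝 ((r i * 0) • (b i : m → ℝ))) := by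
    intro i
    have h1 : 0 < η * hA.1.eigenvalues i := mul_pos hη (hA.eigenvalues_pos i)
    have h2 := hs _ (hA.1.eigenvalues_mem_spectrum_real i)
    exact ((tendsto_pow_atTop_nhds_zero_of_abs_lt_one
      (abs_lt.2 ⟨by linarith, by linarith⟩)).const_mul _).smul_const _
  simpa using tendsto_finsetSum Finset.univ fun i _ => hlim i

variable {d K : ℕ} {n : ℕ} {z : ℕ → Obs d K}

theorem gradStep_eq (η : ℝ) (z : ℕ → Obs d K) (S : Finset ℕ) (θ : Fin (d + 1) → ℝ) :
    gradStep η z S θ = θ + (η * (2 / (S.card : ℝ))) • score z S θ := by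
  rw [gradStep, ← score, smul_smul, mul_neg, neg_smul, sub_neg_eq_add]

/-- A round of FedAvg with a single local step is a step of gradient descent on the pooled data. -/
theorem fedAvgRound_one (η : ℝ) (w : Fin 2) (hw : (armIdx n z w).card ≠ 0)
    (θ : Fin (d + 1) → ℝ) :
    fedAvgRound 1 η n z w θ =
      θ + (η * (2 / ((armIdx n z w).card : ℝ))) • score z (armIdx n z w) θ := by
  have hw' : ((armIdx n z w).card : ℝ) ≠ 0 := Nat.cast_ne_zero.2 hw
  have h1 : ∑ k, ((cellIdx n z k w).card : ℝ) / ((armIdx n z w).card : ℝ) = 1 := by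
    rw [← Finset.sum_div, sum_card_cellIdx, div_self hw']
  simp only [fedAvgRound, Function.iterate_one, gradStep_eq, smul_add, Finset.sum_add_distrib,
    ← Finset.sum_smul, h1, one_smul]
  rw [score_armIdx, Finset.smul_sum]
  congr 1
  refine Finset.sum_congr rfl fun k _ => ?_
  -- In an empty cell both the weight and the score are zero, so the division by zero in the step
  -- size is harmless.
  rcases eq_or_ne (cellIdx n z k w).card 0 with h | h
  · rw [Finset.card_eq_zero.1 h]
    simp [score]
  · have : ((cellIdx n z k w).card : ℝ) ≠ 0 := Nat.cast_ne_zero.2 h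
    rw [smul_smul]
    congr 1
    field_simp

/-- By the normal equations the pooled OLS is the fixed point of a round, and the error is
multiplied by `1 - η A`, `A` being the Hessian of the pooled mean squared error. -/
theorem tendsto_fedAvg_one (w : Fin 2) {η : ℝ} (θ₀ : Fin (d + 1) → ℝ)
    (hG : IsUnit (gram z (armIdx n z w)).det) (hη : 0 < η)
    (hs : ∀ l ∈ spectrum ℝ ((2 / ((armIdx n z w).card : ℝ)) • gram z (armIdx n z w)),
      η * l < 2) :
    Tendsto (fedAvg 1 η θ₀ n z w) atTop (𝓝 (thetaPool n z w)) := by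
  have hw := card_ne_zero_of_isUnit_det hG
  have hw' : (0 : ℝ) < 2 / ((armIdx n z w).card : ℝ) :=
    div_pos two_pos (Nat.cast_pos.2 (Nat.pos_of_ne_zero hw))
  set A := (2 / ((armIdx n z w).card : ℝ)) • gram z (armIdx n z w) with hA
  have hpd : A.PosDef := ((posDef_gram_iff z _).2 hG).smul hw'
  have hnormal : (gram z (armIdx n z w)).mulVec (thetaPool n z w) =
      moment z (armIdx n z w) := by
    rw [thetaPool, ols, Matrix.mulVec_mulVec, Matrix.mul_nonsing_inv _ hG, Matrix.one_mulVec]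
  have hround : ∀ θ, fedAvgRound 1 η n z w θ - thetaPool n z w =
      (1 - η • A).mulVec (θ - thetaPool n z w) := by
    intro θ
    rw [fedAvgRound_one η w hw, score_eq, ← hnormal, ← Matrix.mulVec_sub, Matrix.sub_mulVec,
      Matrix.one_mulVec, hA, smul_smul, Matrix.smul_mulVec,
      ← neg_sub θ (thetaPool n z w), Matrix.mulVec_neg, smul_neg]
    abel
  have hiter : ∀ T, fedAvg 1 η θ₀ n z w T - thetaPool n z w =
      ((1 - η • A) ^ T).mulVec (θ₀ - thetaPool n z w) := by
    intro T
    induction T with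
    | zero => simp [fedAvg]
    | succ T ih =>
      rw [fedAvg, Function.iterate_succ_apply', hround, ← fedAvg, ih, Matrix.mulVec_mulVec,
        pow_succ']
  rw [← tendsto_sub_nhds_zero_iff]
  simp only [hiter]
  exact tendsto_one_sub_smul_pow_mulVec hpd hη hs _

end GradientDescent

/-! ### Local and meta-analysis estimators. -/

section Model

variable {Ω : Type*} [MeasurableSpace Ω] {P : Measure Ω} [IsProbabilityMeasure P]
  {d K : ℕ} {X : ℕ → Ω → Fin d → ℝ} {W : ℕ → Ω → Fin 2} {H : ℕ → Ω → Fin K}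
  {Y : Fin 2 → ℕ → Ω → ℝ} {ρ prob : Fin K → ℝ} {c : Fin 2 → ℝ} {β : Fin 2 → Fin d → ℝ} {σ : ℝ}
  {Z : Ω → ℕ → Obs d K}

namespace HomogeneousModel

theorem asympNormal_tauLocal (hM : HomogeneousModel P X W H Y ρ prob c β σ)
    (hZ : Z = fun ω i => obs X W H Y i ω) (k : Fin K) :
    AsympNormal P
      (fun n ω => √((studyIdx n (Z ω) k).card : ℝ) * (tauLocal n (Z ω) k - ate P Y))
      (σ ^ 2 / (prob k * (1 - prob k)) +
        (β 1 - β 0) ⬝ᵥ (covMatrix P (X 0)).mulVec (β 1 - β 0)) := by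
  have hZm := hM.measurable_sample_of_eq hZ
  refine hM.asympNormal_weighted_local hZ
    (T := fun n ω => √((studyIdx n (Z ω) k).card : ℝ) * (tauLocal n (Z ω) k - ate P Y))
    -- The random normalization is `√n_k = √(n_k / n) √n`; the factor `√(n_k / n)` is absorbed in
    -- the weight of study `k`.
    (l := fun n ω j => if j = k then √(((studyIdx n (Z ω) k).card : ℝ) / n) else 0)
    (l₀ := fun j => if j = k then √(ρ k) else 0) (fun j => ?_)
    (fun n => (measurableIdx_study hZm n k).card.sqrt.mul
      ((measurable_tauLocal hZm n k).sub_const _)) (bad := fun _ => ∅) (by simp)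
    (fun n ω _ h => ?_) ?_
  · by_cases hj : j = k
    · simp only [hj, if_true]
      refine tendstoInMeasure_of_tendsto_ae (fun n => ((measurableIdx_study hZm n k).card.div_const
        _).sqrt.aestronglyMeasurable) ?_
      filter_upwards [hM.ae_tendsto_card_study hZ k] with ω hω
      exact hω.sqrt
    · simp only [hj, if_false]
      exact tendstoInMeasure_of_tendsto_ae (fun _ => aestronglyMeasurable_const)
        (ae_of_all _ fun _ => tendsto_const_nhds)
  · simp only [ite_mul, zero_mul, Finset.sum_ite_eq', Finset.mem_univ, if_true]
    have hn : (0 : ℝ) < n := Nat.cast_pos.2 (Nat.pos_of_ne_zero (h.ne_zero hM.study_nonempty))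
    rw [← mul_assoc, ← Real.sqrt_mul (by positivity), div_mul_cancel₀ _ hn.ne']
  · rw [Finset.sum_eq_single k]
    · rw [if_pos rfl, Real.sq_sqrt (hM.study_pos k).le, div_self (hM.study_pos k).ne', one_mul]
    · intro j _ hj
      simp [hj]
    · simp

theorem asympNormal_tauMetaSW (hM : HomogeneousModel P X W H Y ρ prob c β σ)
    (hZ : Z = fun ω i => obs X W H Y i ω) :
    AsympNormal P (fun n ω => √(n : ℝ) * (tauMetaSW n (Z ω) - ate P Y))
      (σ ^ 2 * (∑ k, ρ k / (prob k * (1 - prob k))) +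
        (β 1 - β 0) ⬝ᵥ (covMatrix P (X 0)).mulVec (β 1 - β 0)) := by
  have hZm := hM.measurable_sample_of_eq hZ
  refine hM.asympNormal_weighted_local hZ
    (l := fun n ω k => ((studyIdx n (Z ω) k).card : ℝ) / n) (l₀ := ρ)
    (hM.tendstoInMeasure_card_study hZ)
    (fun n => ((measurable_tauMetaSW hZm n).sub_const _).const_mul _) (bad := fun _ => ∅)
    (by simp) (fun n ω _ h => ?_) ?_
  · have hn : (n : ℝ) ≠ 0 := Nat.cast_ne_zero.2 (h.ne_zero hM.study_nonempty)
    have h1 : ∑ k, ((studyIdx n (Z ω) k).card : ℝ) / n = 1 := by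
      rw [← Finset.sum_div, sum_card_studyIdx, div_self hn]
    simp only [mul_left_comm _ (√(n : ℝ)), ← Finset.mul_sum, mul_sub, Finset.sum_sub_distrib,
      ← Finset.sum_mul, h1, one_mul, tauMetaSW]
  · have h1 : ∀ k, ρ k ^ 2 / ρ k = ρ k := fun k => by
      rw [sq, mul_div_assoc, div_self (hM.study_pos k).ne', mul_one]
    simp only [h1, mul_add, Finset.sum_add_distrib, ← Finset.sum_mul, hM.sum_study_prob, one_mul]
    rw [Finset.mul_sum]
    congr 1
    exact Finset.sum_congr rfl fun k _ => by ring

/-- The normalized weights tend to `(ρ_k / V_k) / s` with `s = ∑ ρ_j / V_j`, and the variance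
collapses to `s⁻² ∑ ρ_k / V_k = s⁻¹`. -/
theorem asympNormal_tauMetaIVW (hM : HomogeneousModel P X W H Y ρ prob c β σ)
    (hZ : Z = fun ω i => obs X W H Y i ω) {V : Fin K → ℝ}
    (hV : ∀ k, V k = σ ^ 2 / (prob k * (1 - prob k)) +
      (β 1 - β 0) ⬝ᵥ (covMatrix P (X 0)).mulVec (β 1 - β 0)) (hpos : ∀ k, 0 < V k)
    {v : ℕ → Ω → Fin K → ℝ} (hvm : ∀ n, Measurable (v n))
    (hv : ∀ k, TendstoInMeasure P (fun n ω => ((studyIdx n (Z ω) k).card : ℝ) * v n ω k) atTop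
      (fun _ => V k)) :
    AsympNormal P (fun n ω => √(n : ℝ) * (tauMetaIVW (v n ω) n (Z ω) - ate P Y))
      (∑ k, ρ k / V k)⁻¹ := by
  have hZm := hM.measurable_sample_of_eq hZ
  have : Nonempty (Fin K) := ⟨⟨0, hM.study_nonempty⟩⟩
  have hS : 0 < ∑ k, ρ k / V k :=
    Finset.sum_pos (fun k _ => div_pos (hM.study_pos k) (hpos k)) Finset.univ_nonempty
  -- When `n_k ≠ 0`, the ratio of the two entries is `(n v_k)⁻¹`, also for `v_k = 0`; both entries
  -- have limits by assumption or by the law of large numbers.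
  set f : ℕ → Ω → Fin K ⊕ Fin K → ℝ := fun n ω => Sum.elim
    (fun k => ((studyIdx n (Z ω) k).card : ℝ) / n)
    (fun k => ((studyIdx n (Z ω) k).card : ℝ) * v n ω k) with hf
  have hlim : ∀ j, TendstoInMeasure P (fun n ω => f n ω j) atTop (fun _ => Sum.elim ρ V j) := by
    rintro (k | k)
    · exact hM.tendstoInMeasure_card_study hZ k
    · exact hv k
  have hcont : ∀ k : Fin K, ContinuousAt (fun x : Fin K ⊕ Fin K → ℝ => x (.inl k) / x (.inr k))
      (Sum.elim ρ V) := fun k =>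
    (continuous_apply _).continuousAt.div (continuous_apply _).continuousAt (hpos k).ne'
  have hcontS : ContinuousAt (fun x : Fin K ⊕ Fin K → ℝ => ∑ k : Fin K, x (.inl k) / x (.inr k))
      (Sum.elim ρ V) := tendsto_finsetSum _ fun k _ => hcont k
  -- Nothing prevents the total weight from vanishing, and then the weights do not sum to one; its
  -- limit is positive, so this event is negligible.
  have hbad : Tendsto (fun n => P {ω | ∑ k, f n ω (.inl k) / f n ω (.inr k) = 0}) atTop (𝓝 0) := by
    have h1 := tendstoInMeasure_comp_of_continuousAt hlim hcontS
    rw [tendstoInMeasure_iff_dist] at h1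
    refine tendsto_of_tendsto_of_tendsto_of_le_of_le tendsto_const_nhds (h1 _ hS)
      (fun _ => zero_le) fun n => measure_mono fun ω hω => ?_
    rw [Set.mem_ofPred_eq] at hω ⊢
    rw [hω, Real.dist_eq, zero_sub, abs_neg]
    exact le_abs_self _
  refine hM.asympNormal_weighted_local hZ
    (T := fun n ω => √(n : ℝ) * (tauMetaIVW (v n ω) n (Z ω) - ate P Y))
    (l := fun n ω k => (f n ω (.inl k) / f n ω (.inr k)) /
      ∑ j, f n ω (.inl j) / f n ω (.inr j))
    (l₀ := fun k => (ρ k / V k) / ∑ j, ρ j / V j) (fun k => ?_)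
    (fun n => ((measurable_tauMetaIVW hZm n fun k =>
      (measurable_pi_apply k).comp (hvm n)).sub_const _).const_mul _) hbad
    (fun n ω hω h => ?_) ?_
  · have hc : ContinuousAt (fun x : Fin K ⊕ Fin K → ℝ => (x (.inl k) / x (.inr k)) /
        ∑ j : Fin K, x (.inl j) / x (.inr j)) (Sum.elim ρ V) := (hcont k).div hcontS hS.ne'
    have hl := tendstoInMeasure_comp_of_continuousAt hlim hc
    simp only [Sum.elim_inl, Sum.elim_inr] at hl
    exact hl
  · have hn : (n : ℝ) ≠ 0 := Nat.cast_ne_zero.2 (h.ne_zero hM.study_nonempty)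
    have hw : ∀ k, f n ω (.inl k) / f n ω (.inr k) = (n : ℝ)⁻¹ * (v n ω k)⁻¹ := by
      intro k
      have hk : ((studyIdx n (Z ω) k).card : ℝ) ≠ 0 :=
        Nat.cast_ne_zero.2 (h.card_studyIdx_ne_zero k)
      simp only [hf, Sum.elim_inl, Sum.elim_inr]
      rw [div_div, mul_left_comm, div_mul_cancel_left₀ hk, mul_inv]
    simp only [hw, ← Finset.mul_sum, Set.mem_ofPred_eq, mul_eq_zero, inv_eq_zero, hn,
      false_or] at hω ⊢
    simp only [mul_div_mul_left _ _ (inv_ne_zero hn)]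
    rw [tauMetaIVW]
    simp only [div_mul_eq_mul_div, ← Finset.sum_div, mul_left_comm _ (√(n : ℝ)),
      ← Finset.mul_sum, mul_sub, Finset.sum_sub_distrib, ← Finset.sum_mul]
    generalize ∑ k, (v n ω k)⁻¹ = s at hω ⊢
    field_simp
  · have h1 : ∀ k, ((ρ k / V k) / ∑ j, ρ j / V j) ^ 2 / ρ k * V k =
        (∑ j, ρ j / V j)⁻¹ ^ 2 * (ρ k / V k) := by
      intro k
      have h2 := (hM.study_pos k).ne'
      have h3 := (hpos k).ne'
      generalize ∑ j, ρ j / V j = s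
      field_simp
    simp only [← hV, h1, ← Finset.mul_sum]
    rw [sq, mul_assoc, inv_mul_cancel₀ hS.ne', mul_one]

end HomogeneousModel

end Model

end FedATE

end

/-! ### Assembly of the asymptotic statements. -/

theorem mainTheorem3 {Ω : Type*} [MeasurableSpace Ω] (P : Measure Ω) [IsProbabilityMeasure P]
    {d K : ℕ} (X : ℕ → Ω → Fin d → ℝ) (W : ℕ → Ω → Fin 2) (H : ℕ → Ω → Fin K)
    (Y : Fin 2 → ℕ → Ω → ℝ) (ρ prob : Fin K → ℝ) (c : Fin 2 → ℝ) (β : Fin 2 → Fin d → ℝ)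
    (σ : ℝ) (hM : FedATE.HomogeneousModel P X W H Y ρ prob c β σ)
    (Z : Ω → ℕ → FedATE.Obs d K) (hZ : Z = fun ω i => FedATE.obs X W H Y i ω)
    (τ p : ℝ) (hτ : τ = FedATE.ate P Y) (hp : p = ∑ k, ρ k * prob k)
    (S : Matrix (Fin d) (Fin d) ℝ) (hS : S = FedATE.covMatrix P (X 0))
    (δ : Fin d → ℝ) (hδ : δ = β 1 - β 0)
    (V : Fin K → ℝ) (hV : V = fun k => σ ^ 2 / (prob k * (1 - prob k)) + δ ⬝ᵥ S.mulVec δ) :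
    -- all local design matrices have full rank with probability tending to one
    Tendsto (fun n : ℕ => P {ω | FedATE.LocalFullRank n (Z ω)}) atTop (𝓝 1) ∧
    -- pooled estimator
    FedATE.AsympNormal P (fun n ω => √(n : ℝ) * (FedATE.tauPool n (Z ω) - τ))
      (σ ^ 2 / (p * (1 - p)) + δ ⬝ᵥ S.mulVec δ) ∧
    -- local estimators
    (∀ k, FedATE.AsympNormal P
      (fun n ω => √((FedATE.studyIdx n (Z ω) k).card : ℝ) * (FedATE.tauLocal n (Z ω) k - τ))
      (V k)) ∧
    -- Meta-SW
    FedATE.AsympNormal P (fun n ω => √(n : ℝ) * (FedATE.tauMetaSW n (Z ω) - τ))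
      (σ ^ 2 * (∑ k, ρ k / (prob k * (1 - prob k))) + δ ⬝ᵥ S.mulVec δ) ∧
    -- Meta-IVW, with the asymptotic variances of the local estimators, or with any estimates of
    -- these that are consistent at the scale `1 / n_k`
    ((∀ k, 0 < V k) →
      FedATE.AsympNormal P
        (fun n ω => √(n : ℝ) * (FedATE.tauMetaIVW
          (fun k => V k / ((FedATE.studyIdx n (Z ω) k).card : ℝ))
          n (Z ω) - τ))
        (∑ k, ρ k / V k)⁻¹ ∧
      ∀ v : ℕ → Ω → Fin K → ℝ, (∀ n, Measurable (v n)) →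
        (∀ k, TendstoInMeasure P
          (fun n ω => ((FedATE.studyIdx n (Z ω) k).card : ℝ) * v n ω k) atTop
          (fun _ => V k)) →
        FedATE.AsympNormal P
          (fun n ω => √(n : ℝ) * (FedATE.tauMetaIVW (v n ω) n (Z ω) - τ))
          (∑ k, ρ k / V k)⁻¹) ∧
    -- one-shot estimators
    FedATE.AsympNormal P (fun n ω => √(n : ℝ) * (FedATE.tau1SSW n (Z ω) - τ))
      (σ ^ 2 / (p * (1 - p)) + δ ⬝ᵥ S.mulVec δ) ∧
    (σ ≠ 0 → FedATE.AsympNormal P (fun n ω => √(n : ℝ) * (FedATE.tau1SIVW σ n (Z ω) - τ))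
      (σ ^ 2 / (p * (1 - p)) + δ ⬝ᵥ S.mulVec δ)) ∧
    -- gradient-based estimator, for any FedAvg parameters (possibly depending on the data) with
    -- which FedAvg converges to the pooled OLS parameters under federated full rank
    (∀ (E : ℕ) (η : ℕ → Ω → Fin 2 → ℝ) (θ₀ : ℕ → Ω → Fin 2 → Fin (d + 1) → ℝ),
      (∀ n, Measurable (η n)) → (∀ n, Measurable (θ₀ n)) →
      (∀ n, ∀ᵐ ω ∂P, FedATE.FederatedFullRank n (Z ω) → ∀ w,
        Tendsto (FedATE.fedAvg E (η n ω w) (θ₀ n ω w) n (Z ω) w) atTop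
          (𝓝 (FedATE.thetaPool n (Z ω) w))) →
      FedATE.AsympNormal P
        (fun n ω => √(n : ℝ) * (FedATE.tauGD E (η n ω) (θ₀ n ω) n (Z ω) - τ))
        (σ ^ 2 / (p * (1 - p)) + δ ⬝ᵥ S.mulVec δ)) ∧
    -- such parameters exist: one local step per round and a learning rate below `2 / L`, where
    -- `L` is the largest eigenvalue of the Hessian of the pooled mean squared error
    (∀ (n : ℕ) (z : ℕ → FedATE.Obs d K) (w : Fin 2) (η : ℝ) (θ₀ : Fin (d + 1) → ℝ),
      IsUnit (FedATE.gram z (FedATE.armIdx n z w)).det → 0 < η →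
      (∀ l ∈ spectrum ℝ ((2 / ((FedATE.armIdx n z w).card : ℝ)) •
        FedATE.gram z (FedATE.armIdx n z w)), η * l < 2) →
      Tendsto (FedATE.fedAvg 1 η θ₀ n z w) atTop (𝓝 (FedATE.thetaPool n z w))) := by
  have hZm := hM.measurable_sample_of_eq hZ
  have hpool := fun {T} (hTm : ∀ n, Measurable (T n)) {bad} hbad hT =>
    hM.asympNormal_pool_of_eq hZ (T := T) hTm (bad := bad) hbad hT
  have hVk : ∀ k, V k = σ ^ 2 / (prob k * (1 - prob k)) +
      (β 1 - β 0) ⬝ᵥ (FedATE.covMatrix P (X 0)).mulVec (β 1 - β 0) := by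
    intro k; rw [hV, hδ, hS]
  subst hτ hp hS hδ
  refine ⟨hM.tendsto_measure_localFullRank hZ, ?_, fun k => ?_, hM.asympNormal_tauMetaSW hZ,
    fun hpos => ⟨?_, fun v hvm hv => hM.asympNormal_tauMetaIVW hZ hVk hpos hvm hv⟩,
    hM.asympNormal_tau1SSW hZ, fun hσ => ?_, fun E η θ₀ hη hθ₀ hconv => ?_,
    fun n z w η θ₀ hG hη hs => FedATE.tendsto_fedAvg_one w θ₀ hG hη hs⟩
  · exact hpool (fun n => ((FedATE.measurable_tauPool hZm n).sub_const _).const_mul _)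
      (bad := fun _ => ∅) (by simp) fun _ _ _ _ => rfl
  · rw [hVk]
    exact hM.asympNormal_tauLocal hZ k
  · refine hM.asympNormal_tauMetaIVW hZ hVk hpos
      (v := fun n ω k => V k / ((FedATE.studyIdx n (Z ω) k).card : ℝ))
      (fun n => measurable_pi_lambda _ fun k =>
        (FedATE.measurableIdx_study hZm n k).card.const_div _) fun k => ?_
    -- The product `n_k (V_k / n_k)` equals `V_k` once study `k` is nonempty, which is eventually so
    -- almost surely.
    have hcm := fun n => (FedATE.measurableIdx_study hZm n k).card
    refine tendstoInMeasure_of_tendsto_ae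
      (fun n => ((hcm n).mul ((hcm n).const_div _)).aestronglyMeasurable) ?_
    filter_upwards [hM.ae_eventually_localFullRank hZ] with ω hω
    refine tendsto_const_nhds.congr' ?_
    filter_upwards [hω] with n hn
    rw [mul_div_cancel₀ _ (Nat.cast_ne_zero.2 (hn.card_studyIdx_ne_zero k))]
  · refine hpool (fun n => ((FedATE.measurable_tau1SIVW hZm σ n).sub_const _).const_mul _)
      (bad := fun _ => ∅) (by simp) fun n ω _ h => ?_
    rw [FedATE.tau1SIVW, FedATE.aggregateSW_eq, FedATE.tauPool,
      funext (FedATE.theta1SIVW_eq hM.study_nonempty h hσ)]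
  · refine hpool (fun n => ((FedATE.measurable_tauGD hZm E n (hη n) (hθ₀ n)).sub_const
      _).const_mul _) (bad := fun n => {ω | ¬(FedATE.FederatedFullRank n (Z ω) → ∀ w,
        Tendsto (FedATE.fedAvg E (η n ω w) (θ₀ n ω w) n (Z ω) w) atTop
          (𝓝 (FedATE.thetaPool n (Z ω) w)))}) ?_ fun n ω hω h => ?_
    -- Each `bad n` is a null set; off it, under full rank, `limUnder` is the pooled OLS.
    · have h0 := fun n => ae_iff.1 (hconv n)
      simp only [h0]
      exact tendsto_const_nhds
    · have hlim := not_not.1 hω (h.federated hM.study_nonempty)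
      rw [FedATE.tauGD, FedATE.aggregateSW_eq, FedATE.tauPool,
        show FedATE.thetaGD E (η n ω) (θ₀ n ω) n (Z ω) = FedATE.thetaPool n (Z ω) from
          funext fun w => (hlim w).limUnder_eq]
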